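/- **Theorem (Fréchet differentiability of the control-to-state map).** Let $D\subset\mathbb R^d$ be a bounded domain, $T>0$, and let $\mathcal L$ be a densely defined, self-adjoint, positive definite linear operator on $L^2(D)$ with compact inverse. Let $(e_j)_{j\in\mathbb N}$ be an orthonormal basis of $L^2(D)$ with $\mathcal L e_j=\lambda_j e_j$, $0<\lambda_1\le\lambda_2\le\dots$. Let $Q$ be a bounded, self-adjoint, positive semidefinite operator on $L^2(D)$ with $Qe_j=\mu_je_j$ and $\sum_j\mu_j<\infty$. On a probability space $(\Omega,\mathcal F,\mathbb P)$ with a normal filtration $(\mathcal F_t)_{t\in[0,T]}$ let $W=\sum_j\sqrt{\mu_j}\,B_j e_j$ be an $L^2(D)$-valued $Q$-Wiener process on $[0,T]$, where $\sqrt{\mu_j}B_j=\langle W,e_j\rangle$. Let $y_0\in L^2(D)$ be deterministic. For $s>0$ and $j\in\mathbb N$ let $y_j(s,\cdot)$ be the adapted solution, with continuous paths, of $$y_j(s,t)=\langle y_0,e_j\rangle-\int_0^t\lambda_j^s\,y_j(s,\tau)\,d\tau+\sqrt{\mu_j}\,B_j(t),\qquad t\in[0,T],$$ that is, of $dy_j=-\lambda_j^sy_j\,dt+\sqrt{\mu_j}\,dB_j$,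 $y_j(s,0)=\langle y_0,e_j\rangle$, where the solutions are taken pathwise: outside a single null set of $\omega$, the paths are continuous and the equation holds for all $s>0$, all $j$ and all $t\in[0,T]$. Then: 1. Such a family $(y_j(s,\cdot))_{s>0,\,j\in\mathbb N}$ exists. 2. For any such family and for almost every $\omega$: for all $j$ and $t\in[0,T]$ the map $s\mapsto y_j(s,t)$ is twice differentiable on $(0,\infty)$; for every $s>0$ the series $$y(s)=\sum_jy_j(s,\cdot)e_j,\qquad \partial_sy(s)=\sum_j\partial_sy_j(s,\cdot)e_j,\qquad \partial_{ss}^2y(s)=\sum_j\partial_{ss}^2y_j(s,\cdot)e_j$$ converge in $L^2(D\times[0,T])$; and the map $\mathcal S(\omega):(0,\infty)\to L^2(D\times[0,T])$, $s\mapsto y(s)$, is twice Fréchet differentiable at every $\bar s\in(0,\infty)$, with $$\mathcal D_s\mathcal S(\bar s)(h)=h\,\partial_sy(\bar s),\qquad \mathcal D^2_{ss}\mathcal S(\bar s)(h)(\tilde h)=h\tilde h\,\partial^2_{ss}y(\bar s)\qquad (h,\tilde h\in\mathbb R).$$ -/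

import Mathlib

open MeasureTheory ProbabilityTheory Set Filter Topology
open scoped RealInnerProductSpace

noncomputable section

/-- The real Hilbert space `L²(D)` for a subset `D` of `ℝᵈ` with Lebesgue measure. -/
abbrev SpaceL2 {d : ℕ} (D : Set (EuclideanSpace ℝ (Fin d))) : Type :=
  Lp ℝ 2 ((volume : Measure (EuclideanSpace ℝ (Fin d))).restrict D)

/-- Lebesgue measure on the space-time cylinder `D × [0,T]`. -/
abbrev cylinderMeasure {d : ℕ} (D : Set (EuclideanSpace ℝ (Fin d))) (T : ℝ) :
    Measure (EuclideanSpace ℝ (Fin d) × ℝ) :=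
  ((volume : Measure (EuclideanSpace ℝ (Fin d))).restrict D).prod
    ((volume : Measure ℝ).restrict (Icc 0 T))

/-- The real Hilbert space `L²(D × [0,T])`. -/
abbrev CylinderL2 {d : ℕ} (D : Set (EuclideanSpace ℝ (Fin d))) (T : ℝ) : Type :=
  Lp ℝ 2 (cylinderMeasure D T)

/-- Densely defined, self-adjoint, positive definite operators (in general unbounded) with
compact inverse. -/
structure IsPositiveWithCompactInverse {H : Type*} [NormedAddCommGroup H]
    [InnerProductSpace ℝ H] [CompleteSpace H] (A : H →ₗ.[ℝ] H) : Prop where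
  dense_domain : Dense (A.domain : Set H)
  selfAdjoint : IsSelfAdjoint A
  positive : ∀ v : A.domain, (v : H) ≠ 0 → 0 < ⟪A v, (v : H)⟫
  compact_inverse : ∃ K : H →L[ℝ] H, IsCompactOperator K ∧ (∀ v : A.domain, K (A v) = v) ∧
    ∀ w : H, ∃ v : A.domain, (v : H) = K w ∧ A v = w

/-- `e` is an orthonormal basis made of eigenvectors of `A`, and `lam` is the nondecreasing
sequence of the corresponding eigenvalues. -/
structure IsEigenbasis {H : Type*} [NormedAddCommGroup H] [InnerProductSpace ℝ H]
    (A : H →ₗ.[ℝ] H) (e : HilbertBasis ℕ ℝ H) (lam : ℕ → ℝ) : Prop where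
  apply_eq : ∀ j, ∃ h : e j ∈ A.domain, A ⟨e j, h⟩ = lam j • e j
  monotone : Monotone lam

/-- A filtration is normal on `[0,T]` if it is right-continuous there and `ℱ 0` contains all
null events. -/
structure IsNormalFiltration {Ω : Type*} {mΩ : MeasurableSpace Ω} (ℱ : Filtration ℝ mΩ)
    (P : Measure Ω) (T : ℝ) : Prop where
  right_continuous : ∀ t ∈ Ico 0 T, (ℱ t : MeasurableSpace Ω) = ⨅ r ∈ Ioc t T, ℱ r
  null_sets : ∀ A : Set Ω, MeasurableSet A → P A = 0 → MeasurableSet[ℱ 0] A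

/-- `Q`-Wiener processes on `[0,T]` with respect to the filtration `ℱ`. That the increment over
`[r,t]` is centred Gaussian with covariance operator `(t - r) Q` is expressed through its
one-dimensional projections. -/
structure IsQWienerProcess {H : Type*} [NormedAddCommGroup H] [InnerProductSpace ℝ H]
    {Ω : Type*} {mΩ : MeasurableSpace Ω} (Q : H →L[ℝ] H) (T : ℝ) (ℱ : Filtration ℝ mΩ)
    (P : Measure Ω) (W : ℝ → Ω → H) : Prop where
  adapted : ∀ t ∈ Icc 0 T, StronglyMeasurable[ℱ t] (W t)
  initial : ∀ᵐ ω ∂P, W 0 ω = 0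
  continuous_paths : ∀ᵐ ω ∂P, ContinuousOn (fun t => W t ω) (Icc 0 T)
  indep_increments : ∀ r t, 0 ≤ r → r < t → t ≤ T →
    Indep (MeasurableSpace.comap (fun ω => W t ω - W r ω) (borel H)) (ℱ r) P
  gaussian_increments : ∀ r t, 0 ≤ r → r < t → t ≤ T → ∀ v : H,
    P.map (fun ω => ⟪W t ω - W r ω, v⟫) = gaussianReal 0 ((t - r) * ⟪Q v, v⟫).toNNReal

/-- The real Brownian motion `B_j = ⟨W, e_j⟩ / √μ_j`, so that `W = ∑ √μ_j B_j e_j`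
(for `μ_j = 0` the `j`-th term vanishes, and the value of `B_j` plays no role). -/
def coordinateBM {H : Type*} [NormedAddCommGroup H] [InnerProductSpace ℝ H] {Ω : Type*}
    (e : HilbertBasis ℕ ℝ H) (μ : ℕ → ℝ) (W : ℝ → Ω → H) (j : ℕ) (t : ℝ) (ω : Ω) : ℝ :=
  ⟪e j, W t ω⟫ / √(μ j)

/-- The family `y j s t ω` consists of the strong solutions on `[0,T]` of the Itô equations
`dy_j = - λ_j^s y_j dt + √μ_j dB_j`, `y_j(0) = ⟨e_j, y₀⟩`: adapted processes which almost surely,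
for all `s > 0` and all `j`, have continuous paths and satisfy the equation in integral form
(the noise being additive, `∫₀ᵗ √μ_j dB_j = √μ_j B_j(t)`). -/
structure IsModeFamily {H : Type*} [NormedAddCommGroup H] [InnerProductSpace ℝ H]
    {Ω : Type*} {mΩ : MeasurableSpace Ω} (e : HilbertBasis ℕ ℝ H) (lam μ : ℕ → ℝ) (y₀ : H)
    (T : ℝ) (ℱ : Filtration ℝ mΩ) (P : Measure Ω) (W : ℝ → Ω → H)
    (y : ℕ → ℝ → ℝ → Ω → ℝ) : Prop where
  adapted : ∀ j s, 0 < s → ∀ t ∈ Icc 0 T, StronglyMeasurable[ℱ t] (y j s t)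
  solves : ∀ᵐ ω ∂P, ∀ s, 0 < s → ∀ j,
    ContinuousOn (fun t => y j s t ω) (Icc 0 T) ∧
    ∀ t ∈ Icc 0 T, y j s t ω =
      ⟪e j, y₀⟫ - (∫ τ in (0 : ℝ)..t, lam j ^ s * y j s τ ω) + √(μ j) * coordinateBM e μ W j t ω

/-- `z(x,t) = ∑_j f_j(t) e_j(x)`, a series of elements of `L²(D × [0,T])` converging there. -/
def IsEigenSeries {d : ℕ} {D : Set (EuclideanSpace ℝ (Fin d))} {T : ℝ}
    (e : HilbertBasis ℕ ℝ (SpaceL2 D)) (f : ℕ → ℝ → ℝ) (z : CylinderL2 D T) : Prop :=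
  ∃ h : ∀ j, MemLp (fun p : EuclideanSpace ℝ (Fin d) × ℝ => f j p.2 * e j p.1) 2
      (cylinderMeasure D T),
    HasSum (fun j => (h j).toLp) z

end

/-!
Write `F_j = 1_{[0,T]} (⟨e_j, y₀⟩ + √μ_j B_j)`, extended by zero to the past, and `a = λ_j^s`.
Variation of constants and `∫₀^∞ a e^{-aσ} dσ = 1` exhibit the mode as an average of past
increments of the forcing,
`y_j(s,t) = ∫₀^∞ a e^{-aσ} (F_j(t) - F_j(t-σ)) dσ` for `t ∈ [0,T]`.
Since `d/ds = (log λ_j) a d/da`, the `n`-th derivative in `s` is `(log λ_j)^n` times such an average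
with `e^{-x}` replaced by some `p_n(x) e^{-x}`, `p_n` a polynomial. Cauchy–Schwarz with the weight
`σ^{3/2}` bounds it by `C |log λ_j|^n λ_j^{-s/4}` times the square root of the energy
`∫₀^∞ σ^{-3/2} (F_j(t) - F_j(t-σ))² dσ`, and the power of `λ_j` absorbs the logarithms locally
uniformly in `s > 0`. Brownian increments over a time `σ` have second moment of order `σ`, so the
expected energies, integrated over `[0,T]`, are at most a constant times `μ_j + ⟨e_j, y₀⟩²` (an
exponent `3/2 ∈ (1,2)` makes `σ^{-3/2}` integrable at infinity and `σ^{-3/2} σ` integrable at `0`).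
Almost surely the energies of all modes are therefore summable, and the orthogonal series can be
differentiated termwise to every order.
-/

section Kernel

open Polynomial in
/-- The polynomials `p n` for which the weights `a p n (a σ) e^{-aσ}` are the iterates of
`a e^{-aσ}` under the scaling derivative `a d/da`. -/
noncomputable def decayPoly : ℕ → ℝ[X]
  | 0 => 1
  | n + 1 => decayPoly n + X * (derivative (decayPoly n) - decayPoly n)

/-- The profile `p n (x) e^{-x}` of the `n`-th scaling derivative of the exponential weight
`a e^{-aσ}`. -/
noncomputable def decayKernel (n : ℕ) (x : ℝ) : ℝ := (decayPoly n).eval x * Real.exp (-x)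

theorem decayKernel_zero (x : ℝ) : decayKernel 0 x = Real.exp (-x) := by
  simp [decayKernel, decayPoly]

@[fun_prop]
theorem continuous_decayKernel (n : ℕ) : Continuous (decayKernel n) := by
  unfold decayKernel
  fun_prop

theorem hasDerivAt_mul_decayKernel (n : ℕ) (σ a : ℝ) :
    HasDerivAt (fun a => a * decayKernel n (a * σ)) (decayKernel (n + 1) (a * σ)) a := by
  have hlin : HasDerivAt (fun a => a * σ) σ a := by simpa using (hasDerivAt_id a).mul_const σ
  have hker := (((decayPoly n).hasDerivAt (a * σ)).comp a hlin).mul hlin.neg.exp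
  refine ((hasDerivAt_id a).mul hker).congr_deriv ?_
  simp only [decayKernel, decayPoly, Polynomial.eval_add, Polynomial.eval_mul, Polynomial.eval_X,
    Polynomial.eval_sub, Function.comp_apply, Pi.mul_apply, Pi.neg_apply, id]
  ring

theorem exists_abs_polynomial_eval_le (p : Polynomial ℝ) :
    ∃ C, 0 ≤ C ∧ ∀ x, 0 ≤ x → |p.eval x| ≤ C * Real.exp (x / 2) := by
  induction p using Polynomial.induction_on' with
  | add p q hp hq =>
    obtain ⟨C, hC, h⟩ := hp
    obtain ⟨C', hC', h'⟩ := hq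
    refine ⟨C + C', by positivity, fun x hx => ?_⟩
    rw [Polynomial.eval_add, add_mul]
    exact (abs_add_le _ _).trans (add_le_add (h x hx) (h' x hx))
  | monomial n a =>
    refine ⟨|a| * (2 ^ n * n.factorial), by positivity, fun x hx => ?_⟩
    have h := Real.pow_div_factorial_le_exp (x := x / 2) (by positivity) n
    rw [div_le_iff₀ (by positivity), div_pow, div_le_iff₀ (by positivity)] at h
    rw [Polynomial.eval_monomial, abs_mul, abs_of_nonneg (pow_nonneg hx n), mul_assoc]
    refine mul_le_mul_of_nonneg_left (h.trans (le_of_eq ?_)) (abs_nonneg a)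
    ring

theorem exists_abs_decayKernel_le (n : ℕ) :
    ∃ C, 0 ≤ C ∧ ∀ x, 0 ≤ x → |decayKernel n x| ≤ C * Real.exp (-(x / 2)) := by
  obtain ⟨C, hC, h⟩ := exists_abs_polynomial_eval_le (decayPoly n)
  refine ⟨C, hC, fun x hx => ?_⟩
  calc |decayKernel n x| ≤ C * Real.exp (x / 2) * Real.exp (-x) := by
        rw [decayKernel, abs_mul, Real.abs_exp]
        exact mul_le_mul_of_nonneg_right (h x hx) (Real.exp_pos _).le
    _ = C * Real.exp (-(x / 2)) := by
        rw [mul_assoc, ← Real.exp_add]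
        ring_nf

/-- The average of `Δ` over `(0, ∞)` against the `n`-th scaling derivative of the exponential
weight `a e^{-aσ}`. -/
noncomputable def decayAverage (n : ℕ) (Δ : ℝ → ℝ) (a : ℝ) : ℝ :=
  ∫ σ in Ioi (0 : ℝ), a * decayKernel n (a * σ) * Δ σ

theorem exists_abs_decayKernel_mul_le (n : ℕ) {a : ℝ} (ha : 0 < a) {Δ : ℝ → ℝ} {M : ℝ}
    (hM : ∀ σ, |Δ σ| ≤ M) : ∃ K, ∀ b ∈ Ioi (a / 2), ∀ σ ∈ Ioi (0 : ℝ),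
      |decayKernel n (b * σ) * Δ σ| ≤ K * Real.exp (-(a / 4) * σ) := by
  obtain ⟨C, hC, hCb⟩ := exists_abs_decayKernel_le n
  refine ⟨C * M, fun b (hb : a / 2 < b) σ (hσ : 0 < σ) => ?_⟩
  have hexp : Real.exp (-(b * σ / 2)) ≤ Real.exp (-(a / 4) * σ) :=
    Real.exp_le_exp.2 (by nlinarith)
  rw [abs_mul, mul_right_comm]
  exact mul_le_mul ((hCb _ (by nlinarith)).trans (mul_le_mul_of_nonneg_left hexp hC)) (hM σ)
    (abs_nonneg _) (by positivity)

theorem hasDerivAt_decayAverage (n : ℕ) {Δ : ℝ → ℝ} (hΔ : Measurable Δ) {M : ℝ}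
    (hM : ∀ σ, |Δ σ| ≤ M) {a : ℝ} (ha : 0 < a) :
    HasDerivAt (decayAverage n Δ) (decayAverage (n + 1) Δ a / a) a := by
  have hint : ∀ K : ℝ, IntegrableOn (fun σ => K * Real.exp (-(a / 4) * σ)) (Ioi 0) := fun K =>
    (integrableOn_exp_mul_Ioi (by linarith) 0).const_mul K
  obtain ⟨K₀, hK₀⟩ := exists_abs_decayKernel_mul_le n ha hM
  obtain ⟨K₁, hK₁⟩ := exists_abs_decayKernel_mul_le (n + 1) ha hM
  have hmeas : ∀ (k : ℕ) (b : ℝ), Measurable fun σ => decayKernel k (b * σ) * Δ σ := by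
    fun_prop
  have hF : ∀ b, Measurable fun σ => b * decayKernel n (b * σ) * Δ σ := by fun_prop
  have hF₀ : IntegrableOn (fun σ => a * decayKernel n (a * σ) * Δ σ) (Ioi 0) := by
    simp only [mul_assoc]
    refine ((hint K₀).mono' (hmeas n a).aestronglyMeasurable ?_).const_mul a
    filter_upwards [ae_restrict_mem measurableSet_Ioi] with σ hσ
    exact hK₀ a (half_lt_self ha) σ hσ
  refine (hasDerivAt_integral_of_dominated_loc_of_deriv_le
    (F' := fun b σ => decayKernel (n + 1) (b * σ) * Δ σ) (Ioi_mem_nhds (half_lt_self ha))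
    (.of_forall fun b => (hF b).aestronglyMeasurable) hF₀
    (hmeas (n + 1) a).aestronglyMeasurable
    ((ae_restrict_mem measurableSet_Ioi).mono fun σ hσ b hb => hK₁ b hb σ hσ) (hint K₁)
    (.of_forall fun σ b _ => (hasDerivAt_mul_decayKernel n σ b).mul_const _)).2.congr_deriv ?_
  rw [eq_div_iff ha.ne', mul_comm, decayAverage, ← integral_const_mul]
  simp only [mul_assoc]

theorem enorm_integral_mul_sq_le {α : Type*} [MeasurableSpace α] {ν : Measure α} {k Δ : α → ℝ}
    (hk : AEMeasurable k ν) (hΔ : AEMeasurable Δ ν) {w : α → ENNReal} (hw : AEMeasurable w ν)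
    (hw_zero : ∀ᵐ x ∂ν, w x ≠ 0) (hw_top : ∀ᵐ x ∂ν, w x ≠ ⊤) :
    ‖∫ x, k x * Δ x ∂ν‖ₑ ^ 2 ≤
      (∫⁻ x, w x * ‖k x‖ₑ ^ 2 ∂ν) * ∫⁻ x, (w x)⁻¹ * ‖Δ x‖ₑ ^ 2 ∂ν := by
  have hsqrt : ∀ z : ENNReal, (z ^ (1 / 2 : ℝ)) ^ 2 = z := fun z => by
    rw [← ENNReal.rpow_natCast, ← ENNReal.rpow_mul]
    norm_num
  have hsplit : ∫⁻ x, ‖k x * Δ x‖ₑ ∂ν =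
      ∫⁻ x, (w x ^ (1 / 2 : ℝ) * ‖k x‖ₑ) * ((w x)⁻¹ ^ (1 / 2 : ℝ) * ‖Δ x‖ₑ) ∂ν := by
    refine lintegral_congr_ae ?_
    filter_upwards [hw_zero, hw_top] with x h₀ h₁
    have hone : w x ^ (1 / 2 : ℝ) * (w x)⁻¹ ^ (1 / 2 : ℝ) = 1 := by
      rw [← ENNReal.mul_rpow_of_nonneg _ _ (by norm_num), ENNReal.mul_inv_cancel h₀ h₁,
        ENNReal.one_rpow]
    rw [mul_mul_mul_comm, hone, one_mul, enorm_mul]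
  have hholder := ENNReal.lintegral_mul_le_Lp_mul_Lq ν Real.HolderConjugate.two_two
    ((hw.pow_const (1 / 2 : ℝ)).mul hk.enorm) ((hw.inv.pow_const (1 / 2 : ℝ)).mul hΔ.enorm)
  simp only [Pi.mul_apply, Pi.inv_apply, ENNReal.rpow_two, mul_pow, hsqrt] at hholder
  calc ‖∫ x, k x * Δ x ∂ν‖ₑ ^ 2 ≤ (∫⁻ x, ‖k x * Δ x‖ₑ ∂ν) ^ 2 := by
        gcongr
        exact enorm_integral_le_lintegral_enorm _
    _ ≤ _ := by
        rw [hsplit]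
        refine (pow_le_pow_left' hholder 2).trans_eq ?_
        rw [mul_pow, hsqrt, hsqrt]

theorem exists_lintegral_decayKernel_sq_le (n : ℕ) : ∃ C, 0 ≤ C ∧ ∀ a, 0 < a →
    ∫⁻ σ in Ioi (0 : ℝ), ENNReal.ofReal (σ ^ (3 / 2 : ℝ)) * ‖a * decayKernel n (a * σ)‖ₑ ^ 2 ≤
      ENNReal.ofReal (C * a ^ (-(1 / 2) : ℝ)) := by
  obtain ⟨C, -, hCb⟩ := exists_abs_decayKernel_le n
  refine ⟨C ^ 2 * Real.Gamma (5 / 2), by positivity, fun a ha => ?_⟩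
  have hint : IntegrableOn (fun σ : ℝ => a ^ 2 * C ^ 2 *
      (σ ^ (5 / 2 - 1 : ℝ) * Real.exp (-(a * σ)))) (Ioi 0) := by
    have := integrableOn_rpow_mul_exp_neg_mul_rpow (p := 1) (s := 5 / 2 - 1) (by norm_num)
      one_pos ha
    simp only [Real.rpow_one, neg_mul] at this
    exact this.const_mul _
  have hpow : a ^ 2 * a ^ (-(5 / 2) : ℝ) = a ^ (-(1 / 2) : ℝ) := by
    rw [← Real.rpow_natCast, ← Real.rpow_add ha]
    norm_num
  have hval : ∫ σ in Ioi (0 : ℝ), a ^ 2 * C ^ 2 * (σ ^ (5 / 2 - 1 : ℝ) * Real.exp (-(a * σ))) =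
      C ^ 2 * Real.Gamma (5 / 2) * a ^ (-(1 / 2) : ℝ) := by
    rw [integral_const_mul, Real.integral_rpow_mul_exp_neg_mul_Ioi (by norm_num) ha, one_div,
      Real.inv_rpow ha.le, ← Real.rpow_neg ha.le, ← hpow]
    ring
  have hnonneg : ∀ σ ∈ Ioi (0 : ℝ),
      0 ≤ a ^ 2 * C ^ 2 * (σ ^ (5 / 2 - 1 : ℝ) * Real.exp (-(a * σ))) := fun σ hσ => by
    have : (0 : ℝ) < σ := hσ
    positivity
  rw [← hval, ofReal_integral_eq_lintegral_ofReal hint (ae_restrict_of_forall_mem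
    measurableSet_Ioi hnonneg)]
  refine setLIntegral_mono' measurableSet_Ioi fun σ hσ => ?_
  have hσ : (0 : ℝ) < σ := hσ
  rw [Real.enorm_eq_ofReal_abs, ← ENNReal.ofReal_pow (abs_nonneg _),
    ← ENNReal.ofReal_mul (by positivity), abs_mul, abs_of_pos ha]
  refine ENNReal.ofReal_le_ofReal ?_
  calc σ ^ (3 / 2 : ℝ) * (a * |decayKernel n (a * σ)|) ^ 2
      ≤ σ ^ (3 / 2 : ℝ) * (a * (C * Real.exp (-(a * σ / 2)))) ^ 2 := by
        gcongr
        exact hCb _ (by positivity)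
    _ = a ^ 2 * C ^ 2 * (σ ^ (5 / 2 - 1 : ℝ) * Real.exp (-(a * σ))) := by
        rw [show -(a * σ) = -(a * σ / 2) + -(a * σ / 2) by ring, Real.exp_add]
        norm_num
        ring

theorem exists_abs_decayAverage_le (n : ℕ) : ∃ C, 0 ≤ C ∧ ∀ (Δ : ℝ → ℝ) (a : ℝ),
    Measurable Δ → 0 < a →
    ∫⁻ σ in Ioi (0 : ℝ), ENNReal.ofReal (σ ^ (-(3 / 2) : ℝ)) * ‖Δ σ‖ₑ ^ 2 ≠ ⊤ →
    |decayAverage n Δ a| ≤ C * a ^ (-(1 / 4) : ℝ) *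
      √(∫⁻ σ in Ioi (0 : ℝ), ENNReal.ofReal (σ ^ (-(3 / 2) : ℝ)) * ‖Δ σ‖ₑ ^ 2).toReal := by
  obtain ⟨C, hC, hCb⟩ := exists_lintegral_decayKernel_sq_le n
  refine ⟨√C, Real.sqrt_nonneg C, fun Δ a hΔ ha hE => ?_⟩
  set E := ∫⁻ σ in Ioi (0 : ℝ), ENNReal.ofReal (σ ^ (-(3 / 2) : ℝ)) * ‖Δ σ‖ₑ ^ 2
  have hpos : ∀ᵐ σ : ℝ ∂volume.restrict (Ioi 0), 0 < σ := ae_restrict_mem measurableSet_Ioi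
  have hinv : ∫⁻ σ in Ioi (0 : ℝ), (ENNReal.ofReal (σ ^ (3 / 2 : ℝ)))⁻¹ * ‖Δ σ‖ₑ ^ 2 = E := by
    refine setLIntegral_congr_fun measurableSet_Ioi fun σ (hσ : 0 < σ) => ?_
    rw [← ENNReal.ofReal_inv_of_pos (by positivity), ← Real.rpow_neg hσ.le]
  have hCS : ‖decayAverage n Δ a‖ₑ ^ 2 ≤ ENNReal.ofReal (C * a ^ (-(1 / 2) : ℝ)) * E := by
    refine (enorm_integral_mul_sq_le (w := fun σ => ENNReal.ofReal (σ ^ (3 / 2 : ℝ)))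
      (by fun_prop) hΔ.aemeasurable (by fun_prop) ?_ (by simp)).trans ?_
    · filter_upwards [hpos] with σ hσ
      simpa using Real.rpow_pos_of_pos hσ _
    · rw [hinv]
      gcongr
      exact hCb a ha
  have hsq : decayAverage n Δ a ^ 2 ≤ C * a ^ (-(1 / 2) : ℝ) * E.toReal := by
    have := ENNReal.toReal_mono (ENNReal.mul_ne_top ENNReal.ofReal_ne_top hE) hCS
    rwa [ENNReal.toReal_pow, toReal_enorm, Real.norm_eq_abs, sq_abs, ENNReal.toReal_mul,
      ENNReal.toReal_ofReal (by positivity)] at this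
  refine (Real.abs_le_sqrt hsq).trans_eq ?_
  rw [Real.sqrt_mul (by positivity), Real.sqrt_mul hC, Real.sqrt_eq_rpow (a ^ _),
    ← Real.rpow_mul ha.le]
  norm_num

end Kernel

section ModeDeriv

theorem abs_pow_le_mul_exp (n : ℕ) {c : ℝ} (hc : 0 < c) (x : ℝ) :
    |x| ^ n ≤ n.factorial * c⁻¹ ^ n * Real.exp (c * |x|) := by
  have h := Real.pow_div_factorial_le_exp (x := c * |x|) (by positivity) n
  rw [div_le_iff₀ (by positivity)] at h
  calc |x| ^ n = c⁻¹ ^ n * (c * |x|) ^ n := by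
        rw [← mul_pow, inv_mul_cancel_left₀ hc.ne']
    _ ≤ c⁻¹ ^ n * (Real.exp (c * |x|) * n.factorial) := by gcongr
    _ = n.factorial * c⁻¹ ^ n * Real.exp (c * |x|) := by ring

theorem abs_log_pow_mul_rpow_le (n : ℕ) {lam₀ s₀ s₁ lam s : ℝ} (hlam₀ : 0 < lam₀) (hs₀ : 0 < s₀)
    (hlam : lam₀ ≤ lam) (hs : s ∈ Icc s₀ s₁) :
    |Real.log lam| ^ n * (lam ^ s) ^ (-(1 / 4) : ℝ) ≤
      n.factorial * (s₀ / 4)⁻¹ ^ n * Real.exp (s₁ * |Real.log lam₀| / 2) := by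
  set l := Real.log lam
  set l₀ := Real.log lam₀
  have hl : l₀ ≤ l := Real.log_le_log hlam₀ hlam
  have hs' : 0 < s := hs₀.trans_le hs.1
  have hexponent : s₀ * |l| / 4 - s * l / 4 ≤ s₁ * |l₀| / 2 := by
    rcases le_total 0 l with h | h
    · have h₁ : s₀ * l ≤ s * l := mul_le_mul_of_nonneg_right hs.1 h
      have h₂ : 0 ≤ s₁ * |l₀| := mul_nonneg (hs'.le.trans hs.2) (abs_nonneg _)
      rw [abs_of_nonneg h]
      linarith
    · have h₁ : s₀ * |l| ≤ s * |l| := mul_le_mul_of_nonneg_right hs.1 (abs_nonneg l)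
      have h₂ : s * |l| ≤ s₁ * |l₀| :=
        mul_le_mul hs.2 (abs_le_abs_of_nonpos h hl) (abs_nonneg l) (hs'.le.trans hs.2)
      rw [abs_of_nonpos h] at h₁ h₂ ⊢
      linarith
  have hrpow : (lam ^ s) ^ (-(1 / 4) : ℝ) = Real.exp (-(s * l / 4)) := by
    rw [Real.rpow_def_of_pos (hlam₀.trans_le hlam), ← Real.exp_mul]
    exact congrArg Real.exp (by ring)
  calc |l| ^ n * (lam ^ s) ^ (-(1 / 4) : ℝ)
      ≤ n.factorial * (s₀ / 4)⁻¹ ^ n * Real.exp (s₀ / 4 * |l|) * Real.exp (-(s * l / 4)) := by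
        rw [hrpow]
        gcongr
        exact abs_pow_le_mul_exp n (by positivity) l
    _ ≤ _ := by
        rw [mul_assoc, ← Real.exp_add]
        gcongr
        linarith

/-- The energy `∫₀^∞ σ^{-3/2} (B(t) - B(t-σ))² dσ` of the past increments of the path `B` at time
`t`, a measure of its regularity. -/
noncomputable def pathEnergy (B : ℝ → ℝ) (t : ℝ) : ENNReal :=
  ∫⁻ σ in Ioi (0 : ℝ), ENNReal.ofReal (σ ^ (-(3 / 2) : ℝ)) * ‖B t - B (t - σ)‖ₑ ^ 2

/-- The `n`-th derivative in `s` of the exponential average, with rate `lam ^ s`, of the past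
increments of `B` at time `t`. -/
noncomputable def modeDeriv (lam : ℝ) (B : ℝ → ℝ) (n : ℕ) (s t : ℝ) : ℝ :=
  Real.log lam ^ n * decayAverage n (fun σ => B t - B (t - σ)) (lam ^ s)

theorem exists_abs_modeDeriv_le (n : ℕ) {lam₀ s₀ : ℝ} (hlam₀ : 0 < lam₀) (hs₀ : 0 < s₀) (s₁ : ℝ) :
    ∃ C, 0 ≤ C ∧ ∀ B : ℝ → ℝ, Measurable B → ∀ lam, lam₀ ≤ lam → ∀ s ∈ Icc s₀ s₁, ∀ t,
      pathEnergy B t ≠ ⊤ → |modeDeriv lam B n s t| ≤ C * √(pathEnergy B t).toReal := by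
  obtain ⟨C, hC, hCb⟩ := exists_abs_decayAverage_le n
  refine ⟨n.factorial * (s₀ / 4)⁻¹ ^ n * Real.exp (s₁ * |Real.log lam₀| / 2) * C, by positivity,
    fun B hB lam hlam s hs t hE => ?_⟩
  have hpow : 0 < lam ^ s := Real.rpow_pos_of_pos (hlam₀.trans_le hlam) s
  calc |modeDeriv lam B n s t|
      ≤ |Real.log lam| ^ n *
        (C * (lam ^ s) ^ (-(1 / 4) : ℝ) * √(pathEnergy B t).toReal) := by
        rw [modeDeriv, abs_mul, abs_pow]
        gcongr
        exact hCb _ _ (by fun_prop) hpow hE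
    _ = |Real.log lam| ^ n * (lam ^ s) ^ (-(1 / 4) : ℝ) * C * √(pathEnergy B t).toReal := by ring
    _ ≤ _ := by
        gcongr ?_ * _ * _
        exact abs_log_pow_mul_rpow_le n hlam₀ hs₀ hlam hs

variable {B : ℝ → ℝ} (hB : Measurable B)
include hB

theorem measurable_pathEnergy : Measurable (pathEnergy B) :=
  Measurable.lintegral_prod_right (f := fun t σ : ℝ =>
    ENNReal.ofReal (σ ^ (-(3 / 2) : ℝ)) * ‖B t - B (t - σ)‖ₑ ^ 2) (by fun_prop)

theorem measurable_modeDeriv (lam : ℝ) (n : ℕ) (s : ℝ) : Measurable (modeDeriv lam B n s) := by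
  refine (StronglyMeasurable.integral_prod_right (f := fun t σ : ℝ =>
    lam ^ s * decayKernel n (lam ^ s * σ) * (B t - B (t - σ))) ?_).measurable.const_mul _
  exact Measurable.stronglyMeasurable (by fun_prop)

theorem hasDerivAt_modeDeriv {M : ℝ} (hM : ∀ t, |B t| ≤ M) {lam : ℝ} (hlam : 0 < lam) (n : ℕ)
    (s t : ℝ) :
    HasDerivAt (fun s => modeDeriv lam B n s t) (modeDeriv lam B (n + 1) s t) s := by
  have hΔ : ∀ σ, |B t - B (t - σ)| ≤ M + M := fun σ =>
    (abs_sub _ _).trans (add_le_add (hM _) (hM _))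
  have hpow : 0 < lam ^ s := Real.rpow_pos_of_pos hlam s
  refine (((hasDerivAt_decayAverage n (by fun_prop) hΔ hpow).comp s
    (Real.hasStrictDerivAt_const_rpow hlam s).hasDerivAt).const_mul _).congr_deriv ?_
  rw [modeDeriv, pow_succ]
  field_simp

end ModeDeriv

section Duhamel

theorem measurable_indicator_of_continuousOn {f : ℝ → ℝ} {s : Set ℝ} (hs : MeasurableSet s)
    (hf : ContinuousOn f s) : Measurable (s.indicator f) := by
  classical
  rw [← piecewise_eq_indicator]
  exact hf.measurable_piecewise continuousOn_const hs

theorem exists_abs_indicator_le {f : ℝ → ℝ} {s : Set ℝ} (hs : IsCompact s)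
    (hf : ContinuousOn f s) : ∃ M, ∀ t, |s.indicator f t| ≤ M := by
  obtain ⟨M, hM⟩ := hs.exists_bound_of_continuousOn hf
  refine ⟨max M 0, fun t => ?_⟩
  by_cases ht : t ∈ s
  · rw [indicator_of_mem ht]
    exact (hM t ht).trans (le_max_left M 0)
  · simp only [indicator_of_notMem ht, abs_zero, le_max_right]

/-- Variation of constants for the equation `y(t) = f(t) - a ∫₀ᵗ y` with forcing `f`. -/
noncomputable def duhamel (a : ℝ) (f : ℝ → ℝ) (t : ℝ) : ℝ :=
  f t - a * (Real.exp (-(a * t)) * ∫ τ in (0 : ℝ)..t, Real.exp (a * τ) * f τ)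

theorem continuousOn_primitive {g : ℝ → ℝ} {T : ℝ} (hg : ContinuousOn g (Icc 0 T)) :
    ContinuousOn (fun t => ∫ τ in (0 : ℝ)..t, g τ) (Icc 0 T) :=
  intervalIntegral.continuousOn_primitive (hg.integrableOn_Icc) |>.congr fun _ ht =>
    intervalIntegral.integral_of_le ht.1

theorem hasDerivAt_primitive {g : ℝ → ℝ} {T : ℝ} (hg : ContinuousOn g (Icc 0 T)) {t : ℝ}
    (ht : t ∈ Ioo 0 T) : HasDerivAt (fun t => ∫ τ in (0 : ℝ)..t, g τ) (g t) t := by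
  have hIcc : Icc 0 T ∈ 𝓝 t := Icc_mem_nhds ht.1 ht.2
  refine intervalIntegral.integral_hasDerivAt_right
    ((hg.mono (Icc_subset_Icc_right ht.2.le)).intervalIntegrable_of_Icc ht.1.le)
    ((hg.mono Ioo_subset_Icc_self).stronglyMeasurableAtFilter isOpen_Ioo t ht)
    (hg.continuousAt hIcc)

variable {a T : ℝ} {f : ℝ → ℝ} (hf : ContinuousOn f (Icc 0 T))
include hf

theorem continuousOn_duhamel : ContinuousOn (duhamel a f) (Icc 0 T) := by
  have := continuousOn_primitive (g := fun τ => Real.exp (a * τ) * f τ) (by fun_prop)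
  unfold duhamel
  fun_prop

theorem duhamel_eq {t : ℝ} (ht : t ∈ Icc 0 T) :
    duhamel a f t = f t - ∫ τ in (0 : ℝ)..t, a * duhamel a f τ := by
  set Y : ℝ → ℝ := fun t => Real.exp (-(a * t)) * ∫ τ in (0 : ℝ)..t, Real.exp (a * τ) * f τ with hY
  have hef : ContinuousOn (fun τ => Real.exp (a * τ) * f τ) (Icc 0 T) := by fun_prop
  have hYcont : ContinuousOn Y (Icc 0 T) := by
    have := continuousOn_primitive hef
    fun_prop
  have hYderiv : ∀ x ∈ Ioo 0 t, HasDerivAt Y (duhamel a f x) x := by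
    intro x hx
    have hexp : HasDerivAt (fun x => Real.exp (-(a * x))) (Real.exp (-(a * x)) * -(a * 1)) x :=
      ((hasDerivAt_id x).const_mul a).neg.exp
    refine (hexp.mul (hasDerivAt_primitive hef ⟨hx.1, hx.2.trans_le ht.2⟩)).congr_deriv ?_
    rw [← mul_assoc, ← Real.exp_add]
    simp only [neg_add_cancel, Real.exp_zero, duhamel]
    ring
  have hsub : Icc 0 t ⊆ Icc 0 T := Icc_subset_Icc_right ht.2
  have hFTC := intervalIntegral.integral_eq_sub_of_hasDerivAt_of_le ht.1 (hYcont.mono hsub)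
    hYderiv (((continuousOn_duhamel hf).mono hsub).intervalIntegrable_of_Icc ht.1)
  have hY₀ : Y 0 = 0 := by simp [hY]
  rw [intervalIntegral.integral_const_mul, hFTC, hY₀, sub_zero, duhamel]

theorem eq_duhamel {y : ℝ → ℝ} (hy : ContinuousOn y (Icc 0 T))
    (h : ∀ t ∈ Icc 0 T, y t = f t - ∫ τ in (0 : ℝ)..t, a * y τ) {t : ℝ} (ht : t ∈ Icc 0 T) :
    y t = duhamel a f t := by
  simp only [intervalIntegral.integral_const_mul] at h
  have hef : ContinuousOn (fun τ => Real.exp (a * τ) * f τ) (Icc 0 T) := by fun_prop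
  have hcont : ContinuousOn (fun t => Real.exp (a * t) * ∫ τ in (0 : ℝ)..t, y τ) (Icc 0 T) := by
    have := continuousOn_primitive hy
    fun_prop
  have hderiv : ∀ x ∈ Ioo 0 t, HasDerivAt (fun t => Real.exp (a * t) * ∫ τ in (0 : ℝ)..t, y τ)
      (Real.exp (a * x) * f x) x := by
    intro x hx
    have hxT : x ∈ Ioo 0 T := ⟨hx.1, hx.2.trans_le ht.2⟩
    refine (((hasDerivAt_id x).const_mul a).exp.mul
      (hasDerivAt_primitive hy hxT)).congr_deriv ?_
    simp only [id, h x (Ioo_subset_Icc_self hxT)]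
    ring
  have hsub : Icc 0 t ⊆ Icc 0 T := Icc_subset_Icc_right ht.2
  have hFTC := intervalIntegral.integral_eq_sub_of_hasDerivAt_of_le ht.1 (hcont.mono hsub) hderiv
    ((hef.mono hsub).intervalIntegrable_of_Icc ht.1)
  rw [intervalIntegral.integral_same, mul_zero, sub_zero] at hFTC
  rw [h t ht, duhamel, hFTC, ← mul_assoc (Real.exp _), ← Real.exp_add, neg_add_cancel,
    Real.exp_zero, one_mul]

omit hf in
theorem integral_exp_mul_comp_sub_indicator {t : ℝ} (ht : t ∈ Icc 0 T) :
    ∫ σ in Ioi (0 : ℝ), Real.exp (-(a * σ)) * (Icc 0 T).indicator f (t - σ) =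
      Real.exp (-(a * t)) * ∫ τ in (0 : ℝ)..t, Real.exp (a * τ) * f τ := by
  have hzero : ∀ σ ∈ Ioi (0 : ℝ) \ Ioc 0 t,
      Real.exp (-(a * σ)) * (Icc 0 T).indicator f (t - σ) = 0 := by
    rintro σ ⟨hσ, hσt⟩
    have hσt : t < σ := not_le.1 fun h => hσt ⟨hσ, h⟩
    rw [indicator_of_notMem (fun h => by linarith [h.1]), mul_zero]
  have hind : EqOn (fun σ => Real.exp (-(a * σ)) * (Icc 0 T).indicator f (t - σ))
      (fun σ => Real.exp (-(a * t)) * (Real.exp (a * (t - σ)) * f (t - σ))) (Ioc 0 t) := by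
    intro σ hσ
    dsimp only
    have hmem : t - σ ∈ Icc 0 T := ⟨by linarith [hσ.2], by linarith [hσ.1, ht.2]⟩
    rw [indicator_of_mem hmem, ← mul_assoc, ← Real.exp_add]
    ring_nf
  rw [setIntegral_eq_of_subset_of_forall_sdiff_eq_zero measurableSet_Ioi Ioc_subset_Ioi_self
    hzero, setIntegral_congr_fun measurableSet_Ioc hind, integral_const_mul,
    ← intervalIntegral.integral_of_le ht.1,
    intervalIntegral.integral_comp_sub_left (fun τ => Real.exp (a * τ) * f τ), sub_self, sub_zero]

theorem decayAverage_indicator (ha : 0 < a) {t : ℝ} (ht : t ∈ Icc 0 T) :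
    decayAverage 0 (fun σ => (Icc 0 T).indicator f t - (Icc 0 T).indicator f (t - σ)) a =
      duhamel a f t := by
  have hexp : IntegrableOn (fun σ => Real.exp (-(a * σ))) (Ioi 0) := by
    simpa only [neg_mul] using integrableOn_exp_mul_Ioi (neg_lt_zero.2 ha) 0
  obtain ⟨M, hM⟩ := exists_abs_indicator_le isCompact_Icc hf
  have hmeas := measurable_indicator_of_continuousOn measurableSet_Icc hf
  have hpast : IntegrableOn (fun σ => Real.exp (-(a * σ)) * (Icc 0 T).indicator f (t - σ))
      (Ioi 0) :=
    hexp.mul_bdd (c := M) (Measurable.aestronglyMeasurable (by fun_prop))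
      (.of_forall fun σ => hM (t - σ))
  have hone : ∫ σ in Ioi (0 : ℝ), Real.exp (-(a * σ)) = a⁻¹ := by
    have := integral_exp_mul_Ioi (neg_lt_zero.2 ha) 0
    simpa [neg_mul] using this
  simp only [decayAverage, decayKernel_zero, mul_assoc, mul_sub]
  rw [integral_sub ((hexp.mul_const _).const_mul a) (hpast.const_mul a), integral_const_mul,
    integral_mul_const, hone, integral_const_mul, integral_exp_mul_comp_sub_indicator ht,
    mul_inv_cancel_left₀ ha.ne', indicator_of_mem ht, duhamel]

theorem modeDeriv_zero_indicator {lam : ℝ} (hlam : 0 < lam) (s : ℝ) {t : ℝ} (ht : t ∈ Icc 0 T) :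
    modeDeriv lam ((Icc 0 T).indicator f) 0 s t = duhamel (lam ^ s) f t := by
  rw [modeDeriv, pow_zero, one_mul, decayAverage_indicator hf (Real.rpow_pos_of_pos hlam s) ht]

end Duhamel

section Tensor

variable {α β ι : Type*} [MeasurableSpace α] [MeasurableSpace β] {ν : Measure α} {m : Measure β}

theorem memLp_two_mul_prod {f : α → ℝ} {g : β → ℝ} (hf : MemLp f 2 ν) (hg : MemLp g 2 m) :
    MemLp (fun p : β × α => f p.2 * g p.1) 2 (m.prod ν) := by
  have hmeas : AEStronglyMeasurable (fun p : β × α => f p.2 * g p.1) (m.prod ν) :=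
    hf.1.comp_snd.mul hg.1.comp_fst
  rw [memLp_two_iff_integrable_sq hmeas]
  refine (hg.integrable_sq.mul_prod hf.integrable_sq).congr (Eventually.of_forall fun p => ?_)
  exact (mul_comm _ _).trans (mul_pow _ _ 2).symm

/-- The series `∑ⱼ eⱼ ⊗ fⱼ` converges to `z` in `L²(m × ν)`. -/
def IsTensorSeries (e : ι → Lp ℝ 2 m) (f : ι → α → ℝ) (z : Lp ℝ 2 (m.prod ν)) : Prop :=
  ∃ h : ∀ j, MemLp (fun p : β × α => f j p.2 * e j p.1) 2 (m.prod ν),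
    HasSum (fun j => (h j).toLp) z

theorem IsTensorSeries.congr {e : ι → Lp ℝ 2 m} {f f' : ι → α → ℝ} {z : Lp ℝ 2 (m.prod ν)}
    (hf : IsTensorSeries e f z) (hff' : ∀ j, f j =ᵐ[ν] f' j) : IsTensorSeries e f' z := by
  obtain ⟨hmem, hsum⟩ := hf
  have hae : ∀ j, (fun p : β × α => f j p.2 * e j p.1) =ᵐ[m.prod ν] fun p => f' j p.2 * e j p.1 :=
    fun j => (Measure.quasiMeasurePreserving_snd.ae (hff' j)).mono fun p hp => by simp only [hp]
  exact ⟨fun j => (hmem j).ae_eq (hae j),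
    hsum.congr_fun fun j => ((MemLp.toLp_eq_toLp_iff _ _).2 (hae j)).symm⟩

variable [SFinite ν] [SFinite m]

theorem inner_toLp_mul_prod (f f' : Lp ℝ 2 ν) (g g' : Lp ℝ 2 m) :
    ⟪(memLp_two_mul_prod (Lp.memLp f) (Lp.memLp g)).toLp,
      (memLp_two_mul_prod (Lp.memLp f') (Lp.memLp g')).toLp⟫ = ⟪g, g'⟫ * ⟪f, f'⟫ := by
  rw [L2.inner_def, L2.inner_def, L2.inner_def, ← integral_prod_mul]
  refine integral_congr_ae ?_
  filter_upwards [(memLp_two_mul_prod (Lp.memLp f) (Lp.memLp g)).coeFn_toLp,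
    (memLp_two_mul_prod (Lp.memLp f') (Lp.memLp g')).coeFn_toLp] with p h h'
  rw [h, h']
  simp only [RCLike.inner_apply, conj_trivial]
  ring

/-- The isometric embedding `f ↦ g ⊗ f` of `L²(ν)` into `L²(m × ν)` for a unit vector `g`. -/
noncomputable def tensorUnit (g : Lp ℝ 2 m) (hg : ‖g‖ = 1) : Lp ℝ 2 ν →ₗᵢ[ℝ] Lp ℝ 2 (m.prod ν) :=
  LinearMap.isometryOfInner
    { toFun := fun f => (memLp_two_mul_prod (Lp.memLp f) (Lp.memLp g)).toLp
      map_add' := fun f f' => by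
        rw [← MemLp.toLp_add]
        refine (MemLp.toLp_eq_toLp_iff _ _).2 ?_
        filter_upwards [Measure.quasiMeasurePreserving_snd.ae (Lp.coeFn_add f f')] with p hp
        simp only [hp, Pi.add_apply, add_mul]
      map_smul' := fun c f => by
        rw [RingHom.id_apply, ← MemLp.toLp_const_smul]
        refine (MemLp.toLp_eq_toLp_iff _ _).2 ?_
        filter_upwards [Measure.quasiMeasurePreserving_snd.ae (Lp.coeFn_smul c f)] with p hp
        simp only [hp, Pi.smul_apply, smul_eq_mul, mul_assoc] }
    fun f f' => by
      refine (inner_toLp_mul_prod f f' g g).trans ?_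
      rw [real_inner_self_eq_norm_sq, hg, one_pow, one_mul]

theorem orthogonalFamily_tensorUnit {e : ι → Lp ℝ 2 m} (he : Orthonormal ℝ e) :
    OrthogonalFamily ℝ (fun _ : ι => Lp ℝ 2 ν) fun j => tensorUnit (e j) (he.1 j) := by
  intro i j hij f f'
  refine (inner_toLp_mul_prod f f' (e i) (e j)).trans ?_
  rw [he.2 hij, zero_mul]

theorem isTensorSeries_linearIsometry {e : ι → Lp ℝ 2 m} (he : Orthonormal ℝ e)
    (X : lp (fun _ : ι => Lp ℝ 2 ν) 2) :
    IsTensorSeries e (fun j => X j) ((orthogonalFamily_tensorUnit he).linearIsometry X) :=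
  ⟨fun _ => memLp_two_mul_prod (Lp.memLp _) (Lp.memLp _),
    (orthogonalFamily_tensorUnit he).hasSum_linearIsometry X⟩

end Tensor

section SequenceSpace

variable {ι : Type*}

theorem abs_taylor_two_le {u u' u'' : ℝ → ℝ} {C s r : ℝ}
    (hu : ∀ x ∈ uIcc s r, HasDerivAt u (u' x) x) (hu' : ∀ x ∈ uIcc s r, HasDerivAt u' (u'' x) x)
    (hC : ∀ x ∈ uIcc s r, |u'' x| ≤ C) : |u r - u s - (r - s) * u' s| ≤ C * (r - s) ^ 2 := by
  have hC₀ : 0 ≤ C := (abs_nonneg _).trans (hC s left_mem_uIcc)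
  have hu'_sub : ∀ x ∈ uIcc s r, |u' x - u' s| ≤ C * |r - s| := fun x hx =>
    (Convex.norm_image_sub_le_of_norm_hasDerivWithin_le
      (fun y hy => (hu' y hy).hasDerivWithinAt) hC (convex_uIcc s r) left_mem_uIcc hx).trans
      (mul_le_mul_of_nonneg_left (abs_sub_left_of_mem_uIcc hx) hC₀)
  have htaylor := Convex.norm_image_sub_le_of_norm_hasDerivWithin_le
    (f := fun x => u x - x * u' s) (f' := fun x => u' x - u' s) (s := uIcc s r)
    (fun x hx => (((hu x hx).sub ((hasDerivAt_id x).mul_const (u' s))).congr_deriv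
      (by rw [one_mul])).hasDerivWithinAt)
    hu'_sub (convex_uIcc s r) left_mem_uIcc right_mem_uIcc
  rw [Real.norm_eq_abs, Real.norm_eq_abs, mul_assoc, ← sq, sq_abs] at htaylor
  convert htaylor using 2
  ring

theorem hasDerivAt_lp_of_norm_taylor_le {G F : ι → Type*} [∀ j, NormedAddCommGroup (G j)]
    [∀ j, NormedSpace ℝ (G j)] [∀ j, NormedAddCommGroup (F j)] {p : ENNReal} [Fact (1 ≤ p)]
    {X : ℝ → lp G p} {X' : lp G p} {s K : ℝ} (N : lp F p)
    (h : ∀ᶠ r in 𝓝 s, ∀ j, ‖X r j - X s j - (r - s) • X' j‖ ≤ K * (r - s) ^ 2 * ‖N j‖) :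
    HasDerivAt X X' s := by
  have hp : p ≠ 0 := (zero_lt_one.trans_le Fact.out).ne'
  have hN : Memℓp (fun j => ‖N j‖) p := (lp.memℓp N).norm
  let N' : lp (fun _ : ι => ℝ) p := ⟨fun j => ‖N j‖, hN⟩
  have hbigO : (fun r => X r - X s - (r - s) • X') =O[𝓝 s] fun r => (r - s) ^ 2 := by
    refine Asymptotics.IsBigO.of_bound (|K| * ‖N'‖) (h.mono fun r hr => ?_)
    calc ‖X r - X s - (r - s) • X'‖ ≤ ‖(K * (r - s) ^ 2) • N'‖ :=
          lp.norm_mono hp fun j => (hr j).trans <| by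
            rw [lp.coeFn_smul, Pi.smul_apply, smul_eq_mul]
            exact le_abs_self _
      _ = |K| * ‖N'‖ * ‖(r - s) ^ 2‖ := by
            rw [norm_smul, norm_mul, Real.norm_eq_abs]
            ring
  have hsq : (fun x : ℝ => x ^ 2) =o[𝓝 0] fun x => x := by
    simpa only [pow_one] using
      Asymptotics.isLittleO_pow_pow (𝕜 := ℝ) (m := 1) (n := 2) (by norm_num)
  exact hasDerivAt_iff_isLittleO.2
    (hbigO.trans_isLittleO (hsq.comp_tendsto (tendsto_sub_nhds_zero_iff.2 tendsto_id)))

variable {α : Type*} [MeasurableSpace α] {ν : Measure α}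

theorem exists_lp_ae_eq {E F : Type*} [NormedAddCommGroup E] [NormedAddCommGroup F]
    {p q : ENNReal} [Fact (1 ≤ p)] {f : ι → α → E} (hf : ∀ j, AEStronglyMeasurable (f j) ν)
    {g : lp (fun _ : ι => Lp F p ν) q} {K : ℝ} (h : ∀ j, ∀ᵐ t ∂ν, ‖f j t‖ ≤ K * ‖g j t‖) :
    ∃ x : lp (fun _ : ι => Lp E p ν) q, ∀ j, x j =ᵐ[ν] f j := by
  have hmem : ∀ j, MemLp (f j) p ν := fun j => (Lp.memLp (g j)).of_le_mul (hf j) (h j)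
  have hnorm : ∀ j, ‖(hmem j).toLp‖ ≤ ‖|K| * ‖g j‖‖ := fun j => by
    refine (Lp.norm_le_mul_norm_of_ae_le_mul (c := |K|) ?_).trans (le_abs_self _)
    filter_upwards [h j, (hmem j).coeFn_toLp] with t ht htoLp
    rw [htoLp]
    exact ht.trans (mul_le_mul_of_nonneg_right (le_abs_self K) (norm_nonneg _))
  have hbound : Memℓp (fun j => |K| * ‖g j‖) q := (lp.memℓp g).norm.const_smul |K|
  exact ⟨⟨fun j => (hmem j).toLp, hbound.mono' hnorm⟩, fun j => (hmem j).coeFn_toLp⟩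

theorem hasDerivAt_lp_of_ae_eq {u u' u'' : ι → ℝ → α → ℝ} {V : Set ℝ} {s K : ℝ}
    (hV : V ∈ 𝓝 s) (g : lp (fun _ : ι => Lp ℝ 2 ν) 2)
    (hu : ∀ j, ∀ r ∈ V, ∀ t, HasDerivAt (fun x => u j x t) (u' j r t) r)
    (hu' : ∀ j, ∀ r ∈ V, ∀ t, HasDerivAt (fun x => u' j x t) (u'' j r t) r)
    (hbound : ∀ j, ∀ᵐ t ∂ν, ∀ r ∈ V, |u'' j r t| ≤ K * |g j t|)
    {X : ℝ → lp (fun _ : ι => Lp ℝ 2 ν) 2} {X' : lp (fun _ : ι => Lp ℝ 2 ν) 2}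
    (hX : ∀ r ∈ V, ∀ j, X r j =ᵐ[ν] u j r) (hX' : ∀ j, X' j =ᵐ[ν] u' j s) :
    HasDerivAt X X' s := by
  obtain ⟨ε, hε, hball⟩ := Metric.mem_nhds_iff.1 hV
  refine hasDerivAt_lp_of_norm_taylor_le g (K := K) ?_
  filter_upwards [Metric.ball_mem_nhds s hε] with r hr j
  have hsub : uIcc s r ⊆ V := fun x hx => hball <| by
    rw [Metric.mem_ball, Real.dist_eq] at hr ⊢
    exact (abs_sub_left_of_mem_uIcc hx).trans_lt hr
  refine Lp.norm_le_mul_norm_of_ae_le_mul ?_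
  filter_upwards [hbound j, hX r (hball hr) j, hX s (hball (Metric.mem_ball_self hε)) j, hX' j,
    Lp.coeFn_sub (X r j - X s j) ((r - s) • X' j), Lp.coeFn_sub (X r j) (X s j),
    Lp.coeFn_smul (r - s) (X' j)] with t hbt hr hs hs' hsub₁ hsub₂ hsmul
  rw [hsub₁, Pi.sub_apply, hsub₂, Pi.sub_apply, hsmul, Pi.smul_apply, hr, hs, hs', smul_eq_mul,
    Real.norm_eq_abs, Real.norm_eq_abs, mul_right_comm]
  exact abs_taylor_two_le (u := fun x => u j x t) (fun x hx => hu j x (hsub hx) t)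
    (fun x hx => hu' j x (hsub hx) t) fun x hx => hbt x (hsub hx)

theorem exists_lp_hasDerivAt {u : ℕ → ι → ℝ → α → ℝ} {U : Set ℝ} (hU : IsOpen U)
    (g : lp (fun _ : ι => Lp ℝ 2 ν) 2)
    (hmeas : ∀ n j, ∀ s ∈ U, AEStronglyMeasurable (u n j s) ν)
    (hderiv : ∀ n j, ∀ s ∈ U, ∀ t, HasDerivAt (fun r => u n j r t) (u (n + 1) j s t) s)
    (hbound : ∀ n, ∀ s ∈ U, ∃ K, ∃ V ∈ 𝓝 s, ∀ j, ∀ᵐ t ∂ν, ∀ r ∈ V, |u n j r t| ≤ K * |g j t|) :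
    ∃ X : ℕ → ℝ → lp (fun _ : ι => Lp ℝ 2 ν) 2, ∀ n, ∀ s ∈ U,
      (∀ j, X n s j =ᵐ[ν] u n j s) ∧ HasDerivAt (X n) (X (n + 1) s) s := by
  have hex : ∀ n s, s ∈ U → ∃ x : lp (fun _ : ι => Lp ℝ 2 ν) 2, ∀ j, x j =ᵐ[ν] u n j s := by
    intro n s hs
    obtain ⟨K, V, hV, hK⟩ := hbound n s hs
    exact exists_lp_ae_eq (g := g) (K := K) (hmeas n · s hs) fun j =>
      (hK j).mono fun t ht => ht s (mem_of_mem_nhds hV)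
  choose! X hX using hex
  refine ⟨X, fun n s hs => ⟨hX n s hs, ?_⟩⟩
  obtain ⟨K, V, hV, hK⟩ := hbound (n + 2) s hs
  exact hasDerivAt_lp_of_ae_eq (inter_mem hV (hU.mem_nhds hs)) g
    (fun j r hr => hderiv n j r hr.2) (fun j r hr => hderiv (n + 1) j r hr.2)
    (fun j => (hK j).mono fun t ht r hr => ht r hr.1) (fun r hr => hX n r hr.2) (hX (n + 1) s hs)

theorem exists_lp_ae_eq_sqrt {E : ι → α → ENNReal} (hE : ∀ j, AEMeasurable (E j) ν)
    (hsum : ∑' j, ∫⁻ t, E j t ∂ν ≠ ⊤) :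
    ∃ g : lp (fun _ : ι => Lp ℝ 2 ν) 2, ∀ j, g j =ᵐ[ν] fun t => √(E j t).toReal := by
  have hfin : ∀ j, ∫⁻ t, E j t ∂ν ≠ ⊤ := fun j => ENNReal.ne_top_of_tsum_ne_top hsum j
  have hsq : ∀ j, (fun t => √(E j t).toReal ^ 2) = fun t => (E j t).toReal := fun j =>
    funext fun t => Real.sq_sqrt ENNReal.toReal_nonneg
  have hmem : ∀ j, MemLp (fun t => √(E j t).toReal) 2 ν := fun j => by
    rw [memLp_two_iff_integrable_sq (hE j).ennreal_toReal.sqrt.aestronglyMeasurable, hsq]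
    exact integrable_toReal_of_lintegral_ne_top (hE j) (hfin j)
  have hnorm : ∀ j, ‖(hmem j).toLp‖ ^ 2 = (∫⁻ t, E j t ∂ν).toReal := fun j => by
    rw [← integral_toReal (hE j) (ae_lt_top' (hE j) (hfin j)), ← hsq,
      ← real_inner_self_eq_norm_sq, L2.inner_def]
    refine integral_congr_ae ((hmem j).coeFn_toLp.mono fun t ht => ?_)
    simp only [ht, RCLike.inner_apply, conj_trivial, sq]
  have hℓ : Memℓp (fun j => (hmem j).toLp) 2 := memℓp_gen <| by
    simpa only [ENNReal.toReal_ofNat, Real.rpow_ofNat, hnorm] using ENNReal.summable_toReal hsum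
  exact ⟨⟨_, hℓ⟩, fun j => (hmem j).coeFn_toLp⟩

end SequenceSpace

theorem exists_isTensorSeries_modeDeriv {ι β : Type*} [MeasurableSpace β] {m : Measure β}
    [SFinite m] {ν : Measure ℝ} [SFinite ν] {e : ι → Lp ℝ 2 m} (he : Orthonormal ℝ e)
    {lam : ι → ℝ} {lam₀ : ℝ} (hlam₀ : 0 < lam₀) (hlam : ∀ j, lam₀ ≤ lam j) {B : ι → ℝ → ℝ}
    (hB : ∀ j, Measurable (B j)) (hBb : ∀ j, ∃ M, ∀ t, |B j t| ≤ M)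
    (hE : ∑' j, ∫⁻ t, pathEnergy (B j) t ∂ν ≠ ⊤) :
    ∃ S : ℕ → ℝ → Lp ℝ 2 (m.prod ν), ∀ n, ∀ s ∈ Ioi (0 : ℝ),
      IsTensorSeries e (fun j => modeDeriv (lam j) (B j) n s) (S n s) ∧
      HasDerivAt (S n) (S (n + 1) s) s := by
  obtain ⟨g, hg⟩ := exists_lp_ae_eq_sqrt (fun j => (measurable_pathEnergy (hB j)).aemeasurable) hE
  choose M hM using hBb
  have hfin : ∀ j, ∀ᵐ t ∂ν, pathEnergy (B j) t ≠ ⊤ := fun j =>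
    (ae_lt_top (measurable_pathEnergy (hB j)) (ENNReal.ne_top_of_tsum_ne_top hE j)).mono
      fun t ht => ht.ne
  obtain ⟨X, hX⟩ := exists_lp_hasDerivAt (u := fun n j => modeDeriv (lam j) (B j) n) isOpen_Ioi g
    (fun n j s _ => (measurable_modeDeriv (hB j) (lam j) n s).aestronglyMeasurable)
    (fun n j s _ t => hasDerivAt_modeDeriv (hB j) (hM j) (hlam₀.trans_le (hlam j)) n s t)
    fun n s (hs : 0 < s) => by
      obtain ⟨C, -, hC⟩ := exists_abs_modeDeriv_le n hlam₀ (half_pos hs) (s + 1)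
      refine ⟨C, _, Icc_mem_nhds (half_lt_self hs) (lt_add_one s), fun j => ?_⟩
      filter_upwards [hfin j, hg j] with t ht hgt r hr
      rw [hgt, abs_of_nonneg (Real.sqrt_nonneg _)]
      exact hC (B j) (hB j) (lam j) (hlam j) r hr t ht
  let V := (orthogonalFamily_tensorUnit (ν := ν) he).linearIsometry
  exact ⟨fun n s => V (X n s), fun n s hs =>
    ⟨(isTensorSeries_linearIsometry he (X n s)).congr (hX n s hs).1,
      V.toContinuousLinearMap.hasFDerivAt.comp_hasDerivAt s (hX n s hs).2⟩⟩

section Smoothness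

open scoped ContDiff

variable {F : Type*} [NormedAddCommGroup F] [NormedSpace ℝ F]

theorem contDiffOn_infty_of_hasDerivAt {S : ℕ → ℝ → F} {U : Set ℝ} (hU : IsOpen U)
    (hS : ∀ n, ∀ s ∈ U, HasDerivAt (S n) (S (n + 1) s) s) : ContDiffOn ℝ ∞ (S 0) U := by
  have hdiff : ∀ n, DifferentiableOn ℝ (S n) U := fun n s hs =>
    (hS n s hs).differentiableAt.differentiableWithinAt
  suffices h : ∀ n k : ℕ, ContDiffOn ℝ n (S k) U from contDiffOn_infty.2 fun n => h n 0
  intro n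
  induction n with
  | zero => exact fun k => contDiffOn_zero.2 (hdiff k).continuousOn
  | succ n ih =>
    refine fun k => (contDiffOn_succ_iff_deriv_of_isOpen hU).2
      ⟨hdiff k, fun h => (WithTop.natCast_ne_top n h).elim, ?_⟩
    exact (ih (k + 1)).congr fun s hs => (hS k s hs).deriv

theorem iteratedDeriv_eqOn_of_hasDerivAt {S : ℕ → ℝ → F} {U : Set ℝ} (hU : IsOpen U)
    (hS : ∀ n, ∀ s ∈ U, HasDerivAt (S n) (S (n + 1) s) s) (n : ℕ) :
    EqOn (iteratedDeriv n (S 0)) (S n) U := by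
  induction n with
  | zero => exact fun s _ => by rw [iteratedDeriv_zero]
  | succ n ih =>
    intro s hs
    rw [iteratedDeriv_succ, (ih.eventuallyEq_of_mem (hU.mem_nhds hs)).deriv_eq, (hS n s hs).deriv]

theorem fderiv_fderiv_apply_eq_smul_deriv {S : ℝ → F} {s : ℝ} (hS : ContDiffAt ℝ 2 S s) (h k : ℝ) :
    fderiv ℝ (fderiv ℝ S) s h k = (h * k) • deriv (deriv S) s := by
  have hdiff : DifferentiableAt ℝ (fderiv ℝ S) s :=
    (hS.fderiv_right (m := 1) (by norm_num)).differentiableAt one_ne_zero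
  have hderiv : deriv (fun r => fderiv ℝ S r k) s = deriv (fderiv ℝ S) s k := by
    rw [(hdiff.hasDerivAt.clm_apply (hasDerivAt_const s k)).deriv, map_zero, add_zero]
  calc fderiv ℝ (fderiv ℝ S) s h k = h • deriv (fderiv ℝ S) s k := by
        rw [fderiv_eq_smul_deriv, _root_.smul_apply]
    _ = h • deriv (fun r => k • deriv S r) s := by
        simp only [← hderiv, fderiv_eq_smul_deriv k]
    _ = (h * k) • deriv (deriv S) s := by rw [deriv_fun_const_smul_field, smul_smul]

variable {ι β : Type*} [MeasurableSpace β] {m : Measure β}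

theorem exists_contDiffOn_isTensorSeries [SFinite m] {e : ι → Lp ℝ 2 m} (he : Orthonormal ℝ e)
    {lam : ι → ℝ} {lam₀ : ℝ} (hlam₀ : 0 < lam₀) (hlam : ∀ j, lam₀ ≤ lam j) {T : ℝ}
    {f : ι → ℝ → ℝ} (hf : ∀ j, ContinuousOn (f j) (Icc 0 T))
    (hE : ∑' j, ∫⁻ t in Icc 0 T, pathEnergy ((Icc 0 T).indicator (f j)) t ≠ ⊤)
    {y : ι → ℝ → ℝ → ℝ} (hy : ∀ s, 0 < s → ∀ j, ContinuousOn (y j s) (Icc 0 T) ∧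
      ∀ t ∈ Icc 0 T, y j s t = f j t - ∫ τ in (0 : ℝ)..t, lam j ^ s * y j s τ) :
    (∀ j, ∀ t ∈ Icc 0 T, ContDiffOn ℝ ∞ (fun s => y j s t) (Ioi 0)) ∧
      ∃ S : ℝ → Lp ℝ 2 (m.prod (volume.restrict (Icc 0 T))), ContDiffOn ℝ ∞ S (Ioi 0) ∧
        ∀ n, ∀ s ∈ Ioi (0 : ℝ), IsTensorSeries e
          (fun j t => iteratedDeriv n (fun r => y j r t) s) (iteratedDeriv n S s) := by
  set B : ι → ℝ → ℝ := fun j => (Icc 0 T).indicator (f j)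
  have hB : ∀ j, Measurable (B j) := fun j =>
    measurable_indicator_of_continuousOn measurableSet_Icc (hf j)
  have hBb : ∀ j, ∃ M, ∀ t, |B j t| ≤ M := fun j => exists_abs_indicator_le isCompact_Icc (hf j)
  have hmode : ∀ j, ∀ t ∈ Icc 0 T,
      EqOn (fun s => y j s t) (fun s => modeDeriv (lam j) (B j) 0 s t) (Ioi 0) :=
    fun j t ht s hs => by
      beta_reduce
      rw [modeDeriv_zero_indicator (hf j) (hlam₀.trans_le (hlam j)) s ht]
      exact eq_duhamel (hf j) (hy s hs j).1 (hy s hs j).2 ht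
  have hderiv : ∀ j t n, ∀ s ∈ Ioi (0 : ℝ), HasDerivAt (fun s => modeDeriv (lam j) (B j) n s t)
      (modeDeriv (lam j) (B j) (n + 1) s t) s := fun j t n s _ => by
    obtain ⟨M, hM⟩ := hBb j
    exact hasDerivAt_modeDeriv (hB j) hM (hlam₀.trans_le (hlam j)) n s t
  obtain ⟨S, hS⟩ := exists_isTensorSeries_modeDeriv he hlam₀ hlam hB hBb hE
  refine ⟨fun j t ht => (contDiffOn_infty_of_hasDerivAt isOpen_Ioi (hderiv j t)).congr
    (hmode j t ht), S 0, contDiffOn_infty_of_hasDerivAt isOpen_Ioi fun n s hs => (hS n s hs).2,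
    fun n s hs => ?_⟩
  rw [iteratedDeriv_eqOn_of_hasDerivAt isOpen_Ioi (fun n s hs => (hS n s hs).2) n hs]
  refine (hS n s hs).1.congr fun j => (ae_restrict_mem measurableSet_Icc).mono fun t ht => ?_
  exact ((iteratedDeriv_eqOn_of_hasDerivAt isOpen_Ioi (hderiv j t) n).symm.trans
    ((hmode j t ht).iteratedDeriv_of_isOpen isOpen_Ioi n).symm) hs

theorem exists_fderiv_isTensorSeries {e : ι → Lp ℝ 2 m} {ν : Measure ℝ} {E : Set ℝ}
    {y : ι → ℝ → ℝ → ℝ} (hy : ∀ j, ∀ t ∈ E, ContDiffOn ℝ 2 (fun s => y j s t) (Ioi 0))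
    {S : ℝ → Lp ℝ 2 (m.prod ν)} (hS : ContDiffOn ℝ 2 S (Ioi 0))
    (hSy : ∀ n, ∀ s ∈ Ioi (0 : ℝ), IsTensorSeries e
      (fun j t => iteratedDeriv n (fun r => y j r t) s) (iteratedDeriv n S s)) :
    (∀ s, 0 < s → ∀ j, ∀ t ∈ E, DifferentiableAt ℝ (fun r => y j r t) s ∧
      DifferentiableAt ℝ (deriv fun r => y j r t) s) ∧
    ∃ S S₁ S₂ : ℝ → Lp ℝ 2 (m.prod ν), ∀ s, 0 < s →
      IsTensorSeries e (fun j t => y j s t) (S s) ∧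
      IsTensorSeries e (fun j t => deriv (fun r => y j r t) s) (S₁ s) ∧
      IsTensorSeries e (fun j t => deriv (deriv fun r => y j r t) s) (S₂ s) ∧
      DifferentiableAt ℝ S s ∧ DifferentiableAt ℝ (fderiv ℝ S) s ∧
      (∀ h : ℝ, fderiv ℝ S s h = h • S₁ s) ∧
      ∀ h k : ℝ, fderiv ℝ (fderiv ℝ S) s h k = (h * k) • S₂ s := by
  refine ⟨fun s hs j t ht => ?_, S, deriv S, deriv (deriv S), fun s hs => ?_⟩
  · have hat := (hy j t ht).contDiffAt (Ioi_mem_nhds hs)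
    exact ⟨hat.differentiableAt two_ne_zero,
      (hat.derivWithin (m := 1) (by norm_num)).differentiableAt one_ne_zero⟩
  · have hat := hS.contDiffAt (Ioi_mem_nhds hs)
    have h₀ := hSy 0 s hs
    have h₁ := hSy 1 s hs
    have h₂ := hSy 2 s hs
    simp only [iteratedDeriv_zero, iteratedDeriv_succ] at h₀ h₁ h₂
    exact ⟨h₀, h₁, h₂, hat.differentiableAt two_ne_zero,
      (hat.fderiv_right (m := 1) (by norm_num)).differentiableAt one_ne_zero,
      fderiv_eq_smul_deriv, fderiv_fderiv_apply_eq_smul_deriv hat⟩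

end Smoothness

section Energy

theorem lintegral_Ioc_rpow_mul_self {t : ℝ} (ht : 0 ≤ t) :
    ∫⁻ σ in Ioc 0 t, ENNReal.ofReal (σ ^ (-(3 / 2) : ℝ)) * ENNReal.ofReal σ =
      ENNReal.ofReal (2 * t ^ (1 / 2 : ℝ)) := by
  have hint : IntegrableOn (fun σ : ℝ => σ ^ (-(1 / 2) : ℝ)) (Ioc 0 t) :=
    (intervalIntegrable_iff_integrableOn_Ioc_of_le ht).1
      (intervalIntegral.intervalIntegrable_rpow' (by norm_num))
  have hval : ∫ σ in Ioc 0 t, σ ^ (-(1 / 2) : ℝ) = 2 * t ^ (1 / 2 : ℝ) := by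
    rw [← intervalIntegral.integral_of_le ht, integral_rpow (.inl (by norm_num)),
      Real.zero_rpow (by norm_num)]
    norm_num
    ring
  rw [← hval, ofReal_integral_eq_lintegral_ofReal hint
    (ae_restrict_of_forall_mem measurableSet_Ioc fun σ hσ => Real.rpow_nonneg hσ.1.le _)]
  refine setLIntegral_congr_fun measurableSet_Ioc fun σ hσ => ?_
  rw [← ENNReal.ofReal_mul (Real.rpow_nonneg hσ.1.le _), ← Real.rpow_add_one hσ.1.ne']
  norm_num

theorem lintegral_Ioi_rpow_neg {t : ℝ} (ht : 0 < t) :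
    ∫⁻ σ in Ioi t, ENNReal.ofReal (σ ^ (-(3 / 2) : ℝ)) =
      ENNReal.ofReal (2 * t ^ (-(1 / 2) : ℝ)) := by
  have hval : ∫ σ in Ioi t, σ ^ (-(3 / 2) : ℝ) = 2 * t ^ (-(1 / 2) : ℝ) := by
    rw [integral_Ioi_rpow_of_lt (by norm_num) ht]
    norm_num
    ring
  rw [← hval, ofReal_integral_eq_lintegral_ofReal (integrableOn_Ioi_rpow_of_lt (by norm_num) ht)
    (ae_restrict_of_forall_mem measurableSet_Ioi fun σ hσ => Real.rpow_nonneg (ht.trans hσ).le _)]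

theorem lintegral_lintegral_rpow_mul_ite_ne_top (T : ℝ) :
    ∫⁻ t in Icc 0 T, ∫⁻ σ in Ioi (0 : ℝ),
      ENNReal.ofReal (σ ^ (-(3 / 2) : ℝ)) * ENNReal.ofReal (if σ ≤ t then σ else 1) ≠ ⊤ := by
  have hinner : ∀ t ∈ Ioc 0 T, ∫⁻ σ in Ioi (0 : ℝ),
      ENNReal.ofReal (σ ^ (-(3 / 2) : ℝ)) * ENNReal.ofReal (if σ ≤ t then σ else 1) =
      ENNReal.ofReal (2 * t ^ (1 / 2 : ℝ)) + ENNReal.ofReal (2 * t ^ (-(1 / 2) : ℝ)) := by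
    intro t ht
    rw [← lintegral_Ioc_rpow_mul_self ht.1.le, ← lintegral_Ioi_rpow_neg ht.1,
      ← Ioc_union_Ioi_eq_Ioi ht.1.le, lintegral_union measurableSet_Ioi Ioc_disjoint_Ioi_same]
    congr 1
    · refine setLIntegral_congr_fun measurableSet_Ioc fun σ hσ => ?_
      simp only [if_pos hσ.2]
    · refine setLIntegral_congr_fun measurableSet_Ioi fun σ (hσ : t < σ) => ?_
      simp only [if_neg hσ.not_ge, ENNReal.ofReal_one, mul_one]
  have hfin : ∀ p : ℝ, -1 < p → ∫⁻ t in Ioc 0 T, ENNReal.ofReal (2 * t ^ p) ≠ ⊤ := by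
    intro p hp
    rcases le_total 0 T with hT | hT
    · exact (((intervalIntegrable_iff_integrableOn_Ioc_of_le hT).1
        (intervalIntegral.intervalIntegrable_rpow' hp)).const_mul 2).lintegral_lt_top.ne
    · simp [Ioc_eq_empty_of_le hT]
  rw [setLIntegral_congr Ioc_ae_eq_Icc.symm, setLIntegral_congr_fun measurableSet_Ioc hinner,
    lintegral_add_left (by fun_prop)]
  exact ENNReal.add_ne_top.2 ⟨hfin _ (by norm_num), hfin _ (by norm_num)⟩

variable {Ω : Type*} {mΩ : MeasurableSpace Ω} {P : Measure Ω} {T : ℝ}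

theorem lintegral_enorm_past_increment_sq_le {B : ℝ → Ω → ℝ} {K : ENNReal}
    (hpast : ∀ t < 0, ∀ ω, B t ω = 0)
    (hmoment : ∀ t ∈ Icc 0 T, ∫⁻ ω, ‖B t ω‖ₑ ^ 2 ∂P ≤ K)
    (hincr : ∀ r t, 0 ≤ r → r ≤ t → t ≤ T →
      ∫⁻ ω, ‖B t ω - B r ω‖ₑ ^ 2 ∂P ≤ ENNReal.ofReal (t - r) * K)
    {t : ℝ} (ht : t ∈ Icc 0 T) {σ : ℝ} (hσ : 0 ≤ σ) :
    ∫⁻ ω, ‖B t ω - B (t - σ) ω‖ₑ ^ 2 ∂P ≤ ENNReal.ofReal (if σ ≤ t then σ else 1) * K := by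
  split_ifs with hσt
  · simpa only [sub_sub_cancel] using
      hincr (t - σ) t (sub_nonneg.2 hσt) (sub_le_self t hσ) ht.2
  · simp only [hpast (t - σ) (by linarith), sub_zero, ENNReal.ofReal_one, one_mul]
    exact hmoment t ht

theorem measurable_past_increment {B : ℝ → Ω → ℝ} (hB : Measurable (Function.uncurry B)) :
    Measurable fun q : (Ω × ℝ) × ℝ => B q.1.2 q.1.1 - B (q.1.2 - q.2) q.1.1 :=
  (hB.comp (f := fun q : (Ω × ℝ) × ℝ => (q.1.2, q.1.1)) (by fun_prop)).sub
    (hB.comp (f := fun q : (Ω × ℝ) × ℝ => (q.1.2 - q.2, q.1.1)) (by fun_prop))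

theorem measurable_uncurry_pathEnergy {B : ℝ → Ω → ℝ} (hB : Measurable (Function.uncurry B)) :
    Measurable (Function.uncurry fun ω t => pathEnergy (B · ω) t) := by
  have := measurable_past_increment hB
  exact Measurable.lintegral_prod_right' (f := fun q : (Ω × ℝ) × ℝ =>
    ENNReal.ofReal (q.2 ^ (-(3 / 2) : ℝ)) * ‖B q.1.2 q.1.1 - B (q.1.2 - q.2) q.1.1‖ₑ ^ 2)
    (by fun_prop)

theorem lintegral_pathEnergy [SFinite P] {B : ℝ → Ω → ℝ} (hB : Measurable (Function.uncurry B))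
    (t : ℝ) :
    ∫⁻ ω, pathEnergy (B · ω) t ∂P = ∫⁻ σ in Ioi (0 : ℝ),
      ENNReal.ofReal (σ ^ (-(3 / 2) : ℝ)) * ∫⁻ ω, ‖B t ω - B (t - σ) ω‖ₑ ^ 2 ∂P := by
  have hmeas : Measurable (Function.uncurry fun ω σ =>
      ENNReal.ofReal (σ ^ (-(3 / 2) : ℝ)) * ‖B t ω - B (t - σ) ω‖ₑ ^ 2) := by
    have := (measurable_past_increment hB).comp
      (f := fun q : Ω × ℝ => ((q.1, t), q.2)) (by fun_prop)
    exact Measurable.mul (by fun_prop) (this.enorm.pow_const 2)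
  refine (lintegral_lintegral_swap hmeas.aemeasurable).trans (lintegral_congr fun σ => ?_)
  exact lintegral_const_mul' _ _ ENNReal.ofReal_ne_top

theorem lintegral_lintegral_pathEnergy_le [SFinite P] {B : ℝ → Ω → ℝ} {K : ENNReal}
    (hB : Measurable (Function.uncurry B)) (hpast : ∀ t < 0, ∀ ω, B t ω = 0)
    (hmoment : ∀ t ∈ Icc 0 T, ∫⁻ ω, ‖B t ω‖ₑ ^ 2 ∂P ≤ K)
    (hincr : ∀ r t, 0 ≤ r → r ≤ t → t ≤ T →
      ∫⁻ ω, ‖B t ω - B r ω‖ₑ ^ 2 ∂P ≤ ENNReal.ofReal (t - r) * K) :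
    ∫⁻ ω, (∫⁻ t in Icc 0 T, pathEnergy (B · ω) t) ∂P ≤
      (∫⁻ t in Icc 0 T, ∫⁻ σ in Ioi (0 : ℝ), ENNReal.ofReal (σ ^ (-(3 / 2) : ℝ)) *
        ENNReal.ofReal (if σ ≤ t then σ else 1)) * K := by
  have hweight : Measurable (Function.uncurry fun t σ : ℝ =>
      ENNReal.ofReal (σ ^ (-(3 / 2) : ℝ)) * ENNReal.ofReal (if σ ≤ t then σ else 1)) := by
    have : Measurable fun q : ℝ × ℝ => if q.2 ≤ q.1 then q.2 else 1 :=
      Measurable.ite (measurableSet_le measurable_snd measurable_fst) measurable_snd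
        measurable_const
    unfold Function.uncurry
    fun_prop
  rw [lintegral_lintegral_swap (measurable_uncurry_pathEnergy hB).aemeasurable,
    ← lintegral_mul_const _ hweight.lintegral_prod_right]
  refine setLIntegral_mono' measurableSet_Icc fun t ht => ?_
  rw [lintegral_pathEnergy hB, ← lintegral_mul_const _ hweight.of_uncurry_left]
  refine setLIntegral_mono' measurableSet_Ioi fun σ (hσ : 0 < σ) => ?_
  rw [mul_assoc]
  gcongr
  exact lintegral_enorm_past_increment_sq_le hpast hmoment hincr ht hσ.le

theorem ae_tsum_lintegral_pathEnergy_ne_top [SFinite P] {ι : Type*} [Countable ι]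
    {B : ι → ℝ → Ω → ℝ} {K : ι → ENNReal} (hK : ∑' j, K j ≠ ⊤)
    (hB : ∀ j, Measurable (Function.uncurry (B j))) (hpast : ∀ j, ∀ t < 0, ∀ ω, B j t ω = 0)
    (hmoment : ∀ j, ∀ t ∈ Icc 0 T, ∫⁻ ω, ‖B j t ω‖ₑ ^ 2 ∂P ≤ K j)
    (hincr : ∀ j r t, 0 ≤ r → r ≤ t → t ≤ T →
      ∫⁻ ω, ‖B j t ω - B j r ω‖ₑ ^ 2 ∂P ≤ ENNReal.ofReal (t - r) * K j) :
    ∀ᵐ ω ∂P, ∑' j, ∫⁻ t in Icc 0 T, pathEnergy (B j · ω) t ≠ ⊤ := by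
  have hmeas : ∀ j, Measurable fun ω => ∫⁻ t in Icc 0 T, pathEnergy (B j · ω) t := fun j =>
    (measurable_uncurry_pathEnergy (hB j)).lintegral_prod_right
  have hexpect : ∫⁻ ω, (∑' j, ∫⁻ t in Icc 0 T, pathEnergy (B j · ω) t) ∂P ≠ ⊤ := by
    rw [lintegral_tsum fun j => (hmeas j).aemeasurable]
    refine ne_top_of_le_ne_top ?_ (ENNReal.tsum_le_tsum fun j =>
      lintegral_lintegral_pathEnergy_le (hB j) (hpast j) (hmoment j) (hincr j))
    rw [ENNReal.tsum_mul_left]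
    exact ENNReal.mul_ne_top (lintegral_lintegral_rpow_mul_ite_ne_top T) hK
  exact (ae_lt_top (Measurable.tsum hmeas) hexpect).mono fun ω hω => hω.ne

end Energy

section Forcing

theorem measurable_uncurry_indicator_Icc {Ω : Type*} [MeasurableSpace Ω] {X : ℝ → Ω → ℝ} {a b : ℝ}
    (hab : a ≤ b) (hX : ∀ t ∈ Icc a b, Measurable (X t))
    (hXc : ∀ ω, ContinuousOn (fun t => X t ω) (Icc a b)) :
    Measurable (Function.uncurry fun t ω => (Icc a b).indicator (fun t => X t ω) t) := by
  classical
  have hproj : Measurable (Function.uncurry fun t ω => X (projIcc a b hab t) ω) := by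
    refine (stronglyMeasurable_uncurry_of_continuous_of_stronglyMeasurable (fun ω => ?_)
      fun t => (hX _ (projIcc a b hab t).2).stronglyMeasurable).measurable
    exact (continuousOn_iff_continuous_domRestrict.1 (hXc ω)).comp continuous_projIcc
  convert hproj.indicator (measurable_fst (measurableSet_Icc (a := a) (b := b))) using 1
  ext q
  by_cases hq : q.1 ∈ Icc a b
  · simp [Function.uncurry, indicator, hq, projIcc_of_mem hab hq]
  · simp [Function.uncurry, indicator, hq]

theorem measurable_duhamel {Ω : Type*} {mΩ : MeasurableSpace Ω} {X : ℝ → Ω → ℝ} {t : ℝ} (ht : 0 ≤ t)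
    (hX : ∀ r ∈ Icc 0 t, Measurable (X r))
    (hXc : ∀ ω, ContinuousOn (fun r => X r ω) (Icc 0 t)) (a : ℝ) :
    Measurable fun ω => duhamel a (X · ω) t := by
  have hind := measurable_uncurry_indicator_Icc ht hX hXc
  have hint : Measurable fun ω => ∫ τ in (0 : ℝ)..t, Real.exp (a * τ) * X τ ω := by
    have heq : ∀ ω, ∫ τ in (0 : ℝ)..t, Real.exp (a * τ) * X τ ω =
        ∫ τ in Ioc 0 t, Real.exp (a * τ) * (Icc 0 t).indicator (X · ω) τ := fun ω => by
      rw [intervalIntegral.integral_of_le ht]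
      refine setIntegral_congr_fun measurableSet_Ioc fun τ hτ => ?_
      simp only [indicator_of_mem (Ioc_subset_Icc_self hτ)]
    simp only [heq]
    refine (StronglyMeasurable.integral_prod_left (f := fun τ ω =>
      Real.exp (a * τ) * (Icc 0 t).indicator (X · ω) τ) ?_).measurable
    exact (Measurable.mul (by fun_prop) hind).stronglyMeasurable
  exact (hX t ⟨ht, le_rfl⟩).sub ((hint.const_mul _).const_mul _)

variable {H : Type*} [NormedAddCommGroup H] [InnerProductSpace ℝ H] {Ω : Type*}

/-- The forcing `⟨e_j, y₀⟩ + √μ_j B_j(t)` of the `j`-th mode, in which the equation of the mode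
reads `y = F - λ_j^s ∫ y`. -/
noncomputable def modeForcing (e : HilbertBasis ℕ ℝ H) (μ : ℕ → ℝ) (y₀ : H) (W : ℝ → Ω → H)
    (j : ℕ) (t : ℝ) (ω : Ω) : ℝ :=
  ⟪e j, y₀⟫ + √(μ j) * coordinateBM e μ W j t ω

variable {e : HilbertBasis ℕ ℝ H} {μ : ℕ → ℝ} {y₀ : H} {W : ℝ → Ω → H} {T : ℝ}

theorem enorm_modeForcing_sub_le (j : ℕ) (r t : ℝ) (ω : Ω) :
    ‖modeForcing e μ y₀ W j t ω - modeForcing e μ y₀ W j r ω‖ₑ ≤ ‖⟪e j, W t ω - W r ω⟫‖ₑ := by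
  rw [modeForcing, modeForcing, add_sub_add_left_eq_sub, ← mul_sub, coordinateBM, coordinateBM,
    ← sub_div, ← inner_sub_right]
  rcases eq_or_ne (√(μ j)) 0 with h | h
  · simp [h]
  · rw [mul_div_cancel₀ _ h]

theorem modeForcing_of_eq_zero (j : ℕ) {t : ℝ} {ω : Ω} (h : W t ω = 0) :
    modeForcing e μ y₀ W j t ω = ⟪e j, y₀⟫ := by
  simp [modeForcing, coordinateBM, h]

theorem continuousOn_modeForcing (j : ℕ) {ω : Ω} (hW : ContinuousOn (fun t => W t ω) (Icc 0 T)) :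
    ContinuousOn (fun t => modeForcing e μ y₀ W j t ω) (Icc 0 T) := by
  unfold modeForcing coordinateBM
  fun_prop

theorem stronglyMeasurable_modeForcing {m : MeasurableSpace Ω} (j : ℕ) {t : ℝ}
    (hW : StronglyMeasurable (W t)) : StronglyMeasurable (modeForcing e μ y₀ W j t) :=
  Continuous.comp_stronglyMeasurable (g := fun w => ⟪e j, y₀⟫ + √(μ j) * (⟪e j, w⟫ / √(μ j)))
    (by fun_prop) hW

end Forcing

section DrivingNoise

variable {H : Type*} [NormedAddCommGroup H] [InnerProductSpace ℝ H] {Ω : Type*}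
  {mΩ : MeasurableSpace Ω}

/-- Adapted processes with continuous paths started at `0` whose increments over `[r,t]` have, in
the direction of `e j`, second moment at most `(t - r) μ j`: the features of a `Q`-Wiener process on
which the regularity of the control-to-state map rests. -/
structure IsDrivingNoise (e : HilbertBasis ℕ ℝ H) (μ : ℕ → ℝ) (T : ℝ) (ℱ : Filtration ℝ mΩ)
    (P : Measure Ω) (W : ℝ → Ω → H) : Prop where
  adapted : ∀ t ∈ Icc 0 T, StronglyMeasurable[ℱ t] (W t)
  initial : ∀ᵐ ω ∂P, W 0 ω = 0
  continuous_paths : ∀ᵐ ω ∂P, ContinuousOn (fun t => W t ω) (Icc 0 T)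
  second_moment : ∀ j r t, 0 ≤ r → r ≤ t → t ≤ T →
    ∫⁻ ω, ‖⟪e j, W t ω - W r ω⟫‖ₑ ^ 2 ∂P ≤ ENNReal.ofReal ((t - r) * μ j)

theorem lintegral_enorm_sq_gaussianReal (v : NNReal) : ∫⁻ x, ‖x‖ₑ ^ 2 ∂gaussianReal 0 v = v := by
  have hvar := (memLp_id_gaussianReal (μ := 0) (v := v) 2).ofReal_variance_eq
  simpa [evariance, variance_id_gaussianReal] using hvar.symm

variable {e : HilbertBasis ℕ ℝ H} {μ : ℕ → ℝ} {T : ℝ} {ℱ : Filtration ℝ mΩ} {P : Measure Ω}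
  {W : ℝ → Ω → H}

theorem IsQWienerProcess.isDrivingNoise {Q : H →L[ℝ] H} (hW : IsQWienerProcess Q T ℱ P W)
    (hQ : ∀ j, Q (e j) = μ j • e j) : IsDrivingNoise e μ T ℱ P W where
  adapted := hW.adapted
  initial := hW.initial
  continuous_paths := hW.continuous_paths
  second_moment j r t hr hrt ht := by
    rcases hrt.eq_or_lt with rfl | hlt
    · simp
    have hvar : ⟪Q (e j), e j⟫ = μ j := by
      rw [hQ, real_inner_smul_left, real_inner_self_eq_norm_sq, e.orthonormal.1 j, one_pow, mul_one]
    have hmeas : Measurable fun ω => ⟪W t ω - W r ω, e j⟫ := by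
      have hWt := (hW.adapted t ⟨hr.trans hrt, ht⟩).mono (ℱ.le t)
      have hWr := (hW.adapted r ⟨hr, hrt.trans ht⟩).mono (ℱ.le r)
      exact (Continuous.comp_stronglyMeasurable (g := fun w : H => ⟪w, e j⟫) (by fun_prop)
        (hWt.sub hWr)).measurable
    simp only [real_inner_comm _ (e j)]
    rw [← lintegral_map (f := fun x : ℝ => ‖x‖ₑ ^ 2) (by fun_prop) hmeas,
      hW.gaussian_increments r t hr hlt ht, lintegral_enorm_sq_gaussianReal, hvar]
    rfl

theorem IsDrivingNoise.exists_modification (hW : IsDrivingNoise e μ T ℱ P W)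
    (hℱ : ∀ A : Set Ω, MeasurableSet A → P A = 0 → MeasurableSet[ℱ 0] A) :
    ∃ W' : ℝ → Ω → H, (∀ t ∈ Icc 0 T, StronglyMeasurable[ℱ t] (W' t)) ∧
      (∀ ω, ContinuousOn (fun t => W' t ω) (Icc 0 T)) ∧ ∀ᵐ ω ∂P, ∀ t, W' t ω = W t ω := by
  obtain ⟨N, hN, hNmeas, hNnull⟩ := exists_measurable_superset_of_null hW.continuous_paths
  refine ⟨fun t => Nᶜ.indicator (W t), fun t ht => ?_, fun ω => ?_, ?_⟩
  · exact (hW.adapted t ht).indicator (ℱ.mono ht.1 _ (hℱ N hNmeas hNnull)).compl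
  · by_cases hω : ω ∈ N
    · simpa only [indicator_of_notMem (notMem_compl_iff.2 hω)] using continuousOn_const
    · have hωc : ContinuousOn (fun t => W t ω) (Icc 0 T) := not_not.1 fun h => hω (hN h)
      simpa only [indicator_of_mem (mem_compl hω)] using hωc
  · filter_upwards [compl_mem_ae_iff.2 hNnull] with ω hω t
    rw [indicator_of_mem hω]

theorem IsDrivingNoise.congr_ae (hW : IsDrivingNoise e μ T ℱ P W) {W' : ℝ → Ω → H}
    (hW' : ∀ t ∈ Icc 0 T, StronglyMeasurable[ℱ t] (W' t)) (h : ∀ᵐ ω ∂P, ∀ t, W' t ω = W t ω) :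
    IsDrivingNoise e μ T ℱ P W' where
  adapted := hW'
  initial := by filter_upwards [hW.initial, h] with ω h₀ hω using (hω 0).trans h₀
  continuous_paths := by
    filter_upwards [hW.continuous_paths, h] with ω hc hω using by simpa only [hω] using hc
  second_moment j r t hr hrt ht := by
    refine (lintegral_congr_ae ?_).trans_le (hW.second_moment j r t hr hrt ht)
    filter_upwards [h] with ω hω
    simp only [hω]

theorem IsDrivingNoise.lintegral_enorm_modeForcing_sub_sq_le (hW : IsDrivingNoise e μ T ℱ P W)
    (y₀ : H) (j : ℕ) {r t : ℝ} (hr : 0 ≤ r) (hrt : r ≤ t) (ht : t ≤ T) :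
    ∫⁻ ω, ‖modeForcing e μ y₀ W j t ω - modeForcing e μ y₀ W j r ω‖ₑ ^ 2 ∂P ≤
      ENNReal.ofReal ((t - r) * μ j) := by
  refine (lintegral_mono fun ω => ?_).trans (hW.second_moment j r t hr hrt ht)
  gcongr
  exact enorm_modeForcing_sub_le j r t ω

theorem IsDrivingNoise.lintegral_enorm_modeForcing_sq_le (hW : IsDrivingNoise e μ T ℱ P W)
    (y₀ : H) (j : ℕ) {t : ℝ} (ht : t ∈ Icc 0 T) :
    ∫⁻ ω, ‖modeForcing e μ y₀ W j t ω‖ₑ ^ 2 ∂P ≤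
      2 * (ENNReal.ofReal (t * μ j) + ‖⟪e j, y₀⟫‖ₑ ^ 2 * P univ) := by
  have hinc := hW.lintegral_enorm_modeForcing_sub_sq_le y₀ j le_rfl ht.1 ht.2
  rw [sub_zero] at hinc
  calc ∫⁻ ω, ‖modeForcing e μ y₀ W j t ω‖ₑ ^ 2 ∂P
      ≤ ∫⁻ ω, 2 * (‖modeForcing e μ y₀ W j t ω - modeForcing e μ y₀ W j 0 ω‖ₑ ^ 2 +
          ‖⟪e j, y₀⟫‖ₑ ^ 2) ∂P := by
        refine lintegral_mono_ae ?_
        filter_upwards [hW.initial] with ω hω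
        rw [modeForcing_of_eq_zero j hω]
        have htriangle := enorm_add_le (modeForcing e μ y₀ W j t ω - ⟪e j, y₀⟫) ⟪e j, y₀⟫
        rw [sub_add_cancel] at htriangle
        refine (pow_le_pow_left' htriangle 2).trans ?_
        simpa [show (2 : ℝ) - 1 = 1 by norm_num] using
          ENNReal.rpow_add_le_mul_rpow_add_rpow _ _ (one_le_two (α := ℝ))
    _ = 2 * (∫⁻ ω, ‖modeForcing e μ y₀ W j t ω - modeForcing e μ y₀ W j 0 ω‖ₑ ^ 2 ∂P +
          ‖⟪e j, y₀⟫‖ₑ ^ 2 * P univ) := by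
        rw [lintegral_const_mul' _ _ (by simp), lintegral_add_right _ measurable_const,
          lintegral_const]
    _ ≤ _ := by gcongr

theorem IsDrivingNoise.ae_tsum_pathEnergy_modeForcing_ne_top [IsFiniteMeasure P]
    (hT : 0 ≤ T) (hW : IsDrivingNoise e μ T ℱ P W)
    (hWc : ∀ ω, ContinuousOn (fun t => W t ω) (Icc 0 T)) (hμ : Summable μ) (y₀ : H) :
    ∀ᵐ ω ∂P, ∑' j, ∫⁻ t in Icc 0 T,
      pathEnergy ((Icc 0 T).indicator (modeForcing e μ y₀ W j · ω)) t ≠ ⊤ := by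
  refine ae_tsum_lintegral_pathEnergy_ne_top (K := fun j => 2 * (ENNReal.ofReal T *
    ENNReal.ofReal (μ j) + ‖⟪e j, y₀⟫‖ₑ ^ 2 * P univ) + ENNReal.ofReal (μ j))
    (B := fun j t ω => (Icc 0 T).indicator (modeForcing e μ y₀ W j · ω) t)
    ?_ (fun j => ?_) (fun j t ht ω => indicator_of_notMem (ht.not_ge ·.1) _)
    (fun j t ht => ?_) fun j r t hr hrt ht => ?_
  · have hinit : ∑' j, ‖⟪e j, y₀⟫‖ₑ ^ 2 ≠ ⊤ := by
      simpa only [← ofReal_norm, ENNReal.ofReal_pow (norm_nonneg _)] using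
        (e.orthonormal.inner_products_summable y₀).tsum_ofReal_ne_top
    rw [ENNReal.tsum_add, ENNReal.tsum_mul_left, ENNReal.tsum_add, ENNReal.tsum_mul_left,
      ENNReal.tsum_mul_right]
    finiteness [hμ.tsum_ofReal_ne_top]
  · exact measurable_uncurry_indicator_Icc hT (fun t ht => (stronglyMeasurable_modeForcing j
      ((hW.adapted t ht).mono (ℱ.le t))).measurable) fun ω => continuousOn_modeForcing j (hWc ω)
  · simp only [indicator_of_mem ht]
    refine (hW.lintegral_enorm_modeForcing_sq_le y₀ j ht).trans (le_add_right ?_)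
    rw [ENNReal.ofReal_mul ht.1]
    gcongr
    exact ht.2
  · have hr' : r ∈ Icc 0 T := ⟨hr, hrt.trans ht⟩
    have ht' : t ∈ Icc 0 T := ⟨hr.trans hrt, ht⟩
    simp only [indicator_of_mem hr', indicator_of_mem ht']
    refine (hW.lintegral_enorm_modeForcing_sub_sq_le y₀ j hr hrt ht).trans ?_
    rw [ENNReal.ofReal_mul (sub_nonneg.2 hrt)]
    gcongr
    exact le_add_self

theorem IsDrivingNoise.exists_isModeFamily (hW : IsDrivingNoise e μ T ℱ P W)
    (hℱ : ∀ A : Set Ω, MeasurableSet A → P A = 0 → MeasurableSet[ℱ 0] A) (lam : ℕ → ℝ) (y₀ : H) :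
    ∃ y : ℕ → ℝ → ℝ → Ω → ℝ, IsModeFamily e lam μ y₀ T ℱ P W y := by
  obtain ⟨W', hW', hW'c, hWW'⟩ := hW.exists_modification hℱ
  refine ⟨fun j s t ω => duhamel (lam j ^ s) (modeForcing e μ y₀ W' j · ω) t,
    fun j s _ t ht => ?_, ?_⟩
  · refine (measurable_duhamel (mΩ := ℱ t) ht.1 (fun r hr => ?_) (fun ω => ?_) _).stronglyMeasurable
    · exact (stronglyMeasurable_modeForcing j
        ((hW' r ⟨hr.1, hr.2.trans ht.2⟩).mono (ℱ.mono hr.2))).measurable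
    · exact (continuousOn_modeForcing j (hW'c ω)).mono (Icc_subset_Icc_right ht.2)
  · filter_upwards [hWW'] with ω hω s _ j
    have hF := continuousOn_modeForcing (e := e) (μ := μ) (y₀ := y₀) j (hW'c ω)
    refine ⟨continuousOn_duhamel hF, fun t ht => (duhamel_eq hF ht).trans ?_⟩
    rw [modeForcing, coordinateBM, hω, ← coordinateBM]
    ring

end DrivingNoise

theorem IsPositiveWithCompactInverse.eigenvalue_pos {H : Type*} [NormedAddCommGroup H]
    [InnerProductSpace ℝ H] [CompleteSpace H] {A : H →ₗ.[ℝ] H}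
    (hA : IsPositiveWithCompactInverse A) {e : HilbertBasis ℕ ℝ H} {lam : ℕ → ℝ}
    (he : IsEigenbasis A e lam) (j : ℕ) : 0 < lam j := by
  obtain ⟨hmem, happly⟩ := he.apply_eq j
  have hpos := hA.positive ⟨e j, hmem⟩ (e.orthonormal.ne_zero j)
  rwa [happly, real_inner_smul_left, real_inner_self_eq_norm_sq, e.orthonormal.1 j, one_pow,
    mul_one] at hpos

theorem mainTheorem3_general {β : Type*} [MeasurableSpace β] {m : Measure β} [SFinite m]
    (e : HilbertBasis ℕ ℝ (Lp ℝ 2 m)) {lam : ℕ → ℝ} {lam₀ : ℝ} (hlam₀ : 0 < lam₀)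
    (hlam : ∀ j, lam₀ ≤ lam j) {μ : ℕ → ℝ} (hμ : Summable μ) {T : ℝ} (hT : 0 ≤ T)
    {Ω : Type*} {mΩ : MeasurableSpace Ω} {P : Measure Ω} [IsFiniteMeasure P]
    {ℱ : Filtration ℝ mΩ} (hℱ : ∀ A : Set Ω, MeasurableSet A → P A = 0 → MeasurableSet[ℱ 0] A)
    {W : ℝ → Ω → Lp ℝ 2 m} (hW : IsDrivingNoise e μ T ℱ P W) (y₀ : Lp ℝ 2 m) :
    (∃ y : ℕ → ℝ → ℝ → Ω → ℝ, IsModeFamily e lam μ y₀ T ℱ P W y) ∧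
    ∀ y : ℕ → ℝ → ℝ → Ω → ℝ, IsModeFamily e lam μ y₀ T ℱ P W y → ∀ᵐ ω ∂P,
      (∀ j, ∀ t ∈ Icc 0 T, ContDiffOn ℝ (⊤ : ℕ∞) (fun s => y j s t ω) (Ioi 0)) ∧
      ∃ S : ℝ → Lp ℝ 2 (m.prod (volume.restrict (Icc 0 T))), ContDiffOn ℝ (⊤ : ℕ∞) S (Ioi 0) ∧
        ∀ n, ∀ s ∈ Ioi (0 : ℝ), IsTensorSeries e
          (fun j t => iteratedDeriv n (fun r => y j r t ω) s) (iteratedDeriv n S s) := by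
  refine ⟨hW.exists_isModeFamily hℱ lam y₀, fun y hy => ?_⟩
  obtain ⟨W', hW', hW'c, hWW'⟩ := hW.exists_modification hℱ
  filter_upwards [hy.solves, hWW',
    (hW.congr_ae hW' hWW').ae_tsum_pathEnergy_modeForcing_ne_top hT hW'c hμ y₀] with ω hsol hω hE
  refine exists_contDiffOn_isTensorSeries e.orthonormal hlam₀ hlam
    (fun j => continuousOn_modeForcing j (hW'c ω)) hE fun s hs j => ?_
  refine ⟨(hsol s hs j).1, fun t ht => ((hsol s hs j).2 t ht).trans ?_⟩
  simp only [modeForcing, coordinateBM, hω]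
  ring

theorem mainTheorem3 {d : ℕ} (D : Set (EuclideanSpace ℝ (Fin d))) (hD_open : IsOpen D)
    (hD_conn : IsConnected D) (hD_bdd : Bornology.IsBounded D) (T : ℝ) (hT : 0 < T)
    -- the operator, its eigenfunctions and its eigenvalues
    (A : SpaceL2 D →ₗ.[ℝ] SpaceL2 D) (hA : IsPositiveWithCompactInverse A)
    (e : HilbertBasis ℕ ℝ (SpaceL2 D)) (lam : ℕ → ℝ) (he : IsEigenbasis A e lam)
    -- the trace-class covariance operator, diagonal in the same basis
    (Q : SpaceL2 D →L[ℝ] SpaceL2 D) (hQ : Q.IsPositive) (μ : ℕ → ℝ)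
    (hQe : ∀ j, Q (e j) = μ j • e j) (hQ_trace : Summable μ)
    -- the noise
    {Ω : Type*} {mΩ : MeasurableSpace Ω} (P : Measure Ω) [IsProbabilityMeasure P]
    (ℱ : Filtration ℝ mΩ) (hℱ : IsNormalFiltration ℱ P T)
    (W : ℝ → Ω → SpaceL2 D) (hW : IsQWienerProcess Q T ℱ P W)
    -- the deterministic initial condition
    (y₀ : SpaceL2 D) :
    (∃ y : ℕ → ℝ → ℝ → Ω → ℝ, IsModeFamily e lam μ y₀ T ℱ P W y) ∧
    ∀ y : ℕ → ℝ → ℝ → Ω → ℝ, IsModeFamily e lam μ y₀ T ℱ P W y →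
      ∀ᵐ ω ∂P,
        -- the modes can be differentiated twice in `s`
        (∀ s, 0 < s → ∀ j, ∀ t ∈ Icc 0 T,
          DifferentiableAt ℝ (fun r => y j r t ω) s ∧
          DifferentiableAt ℝ (deriv fun r => y j r t ω) s) ∧
        -- the state `S s = y(s)` and its termwise derivatives `S₁ s`, `S₂ s`
        ∃ S S₁ S₂ : ℝ → CylinderL2 D T, ∀ s, 0 < s →
          IsEigenSeries e (fun j t => y j s t ω) (S s) ∧
          IsEigenSeries e (fun j t => deriv (fun r => y j r t ω) s) (S₁ s) ∧
          IsEigenSeries e (fun j t => deriv (deriv fun r => y j r t ω) s) (S₂ s) ∧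
          DifferentiableAt ℝ S s ∧
          DifferentiableAt ℝ (fderiv ℝ S) s ∧
          (∀ h : ℝ, fderiv ℝ S s h = h • S₁ s) ∧
          ∀ h k : ℝ, fderiv ℝ (fderiv ℝ S) s h k = (h * k) • S₂ s := by
  have hlam (j : ℕ) : lam 0 ≤ lam j := he.monotone (Nat.zero_le j)
  obtain ⟨hexists, hsmooth⟩ := mainTheorem3_general e (hA.eigenvalue_pos he 0) hlam hQ_trace hT.le
    hℱ.null_sets (hW.isDrivingNoise hQe) y₀
  refine ⟨hexists, fun y hy => ?_⟩
  filter_upwards [hsmooth y hy] with ω ⟨hmodes, S, hS, hSy⟩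
  exact exists_fderiv_isTensorSeries (fun j t ht => contDiffOn_infty.1 (hmodes j t ht) 2)
    (contDiffOn_infty.1 hS 2) hSy
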